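/- **Definitions.** A finite formal context is a triple $(G,M,I)$ with finite sets $G$ (objects), $M$ (attributes) and $I\subseteq G\times M$; for $A\subseteq G$ put $A'=\{m\in M: gIm\ \forall g\in A\}$, for $B\subseteq M$ put $B'=\{g\in G: gIm\ \forall m\in B\}$; an *intent* is a set $B\subseteq M$ of the form $B=A'$ with $A\subseteq G$ (equivalently $B''=B$). Let $\mathbb K_+=(G_+,M,I_+)$ and $\mathbb K_-=(G_-,M,I_-)$ be finite contexts with a common attribute set $M$ (positive and negative examples). A set $H\subseteq M$ is a *hypothesis* if it is an intent of $\mathbb K_+$ and $H\not\subseteq g^-:=\{m\in M : gI_-m\}$ for every $g\in G_-$. If hypotheses exist, the *minimal hypotheses* are the inclusion-minimal ones; if there are none, then, by convention, $M$ is the only minimal hypothesis. * **AMH** (additional minimal hypothesis). Input: $\mathbb K_+,\mathbb K_-$ and a set $\mathcal H=\{H_1,\dots,H_k\}$ of minimal hypotheses. Question: is there a minimal hypothesis $H\notin\mathcal H$? * **MHE** (minimal hypotheses enumeration). Input: $\mathbb K_+,\mathbb K_-$. Output: the list of all minimal hypotheses, each listed once (in any order). Contexts are encoded as words by their cross-tables,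 and sets of attributes by their characteristic vectors. AMH is *in P* if some (multi-stack) Turing machine answers the question correctly on every input in a number of steps polynomial in the input length. MHE can be solved in *output-polynomial time* if some such machine halts on every input with a correct output, in a number of steps polynomial in the sum of the lengths of the input and of the output. **Statement.** AMH is in P if and only if MHE can be solved in output-polynomial time. -/

import Mathlib

namespace HypothesisEnumeration

/-- A positive context `(G₊, M, I₊)` and a negative context `(G₋, M, I₋)` over a common attribute
set `M`. All sets are finite; `G₊`, `G₋` and `M` are numbered, and the incidence relations are given
by their cross-tables. -/
structure ContextPair where
  /-- number of positive objects, `G₊ = Fin posCard` -/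
  posCard : ℕ
  /-- number of negative objects, `G₋ = Fin negCard` -/
  negCard : ℕ
  /-- number of attributes, `M = Fin attrCard` -/
  attrCard : ℕ
  /-- cross-table of the positive context -/
  posTable : Fin posCard → Fin attrCard → Bool
  /-- cross-table of the negative context -/
  negTable : Fin negCard → Fin attrCard → Bool

namespace ContextPair

variable (K : ContextPair)

/-- The set `M` of attributes. -/
abbrev Attr : Type := Fin K.attrCard

/-- The incidence relation `I₊`. -/
def posRel (g : Fin K.posCard) (j : K.Attr) : Prop := K.posTable g j = true

/-- The incidence relation `I₋`. -/
def negRel (g : Fin K.negCard) (j : K.Attr) : Prop := K.negTable g j = true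

/-- `H ⊆ M` is a (positive) hypothesis: it is an intent of the positive context, and it is not
contained in the intent `g⁻` of any negative example `g`. -/
def IsHypothesis (H : Finset K.Attr) : Prop :=
  Order.IsIntent K.posRel (H : Set K.Attr) ∧
    ∀ g : Fin K.negCard, ¬ (H : Set K.Attr) ⊆ upperPolar K.negRel {g}

/-- `H` is a minimal hypothesis: an inclusion-minimal hypothesis, where, by convention, `M` is the
only minimal hypothesis when there are no hypotheses at all. -/
def IsMinimalHypothesis (H : Finset K.Attr) : Prop :=
  ((∃ F, K.IsHypothesis F) ∧ Minimal K.IsHypothesis H) ∨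
    ((¬ ∃ F, K.IsHypothesis F) ∧ H = Finset.univ)

end ContextPair

/-- An instance of the additional minimal hypothesis problem: a pair of contexts and a set of
minimal hypotheses, listed without repetitions. -/
structure AMHInstance extends ContextPair where
  /-- the given minimal hypotheses `H₁, …, H_k` -/
  known : List (Finset toContextPair.Attr)
  known_nodup : known.Nodup
  known_minimal : ∀ H ∈ known, toContextPair.IsMinimalHypothesis H

/-- The question of the additional minimal hypothesis problem: is there a minimal hypothesis that is
not among the given ones? -/
def AMH (x : AMHInstance) : Prop :=
  ∃ H : Finset x.Attr, x.IsMinimalHypothesis H ∧ H ∉ x.known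

/-! ### Encoding of inputs and outputs as words -/

/-- The alphabet: the two kinds of cells of a cross-table and two end markers. -/
inductive Letter
  | cross
  | blank
  | endRow
  | endTable
  deriving DecidableEq

/-- A row of a cross-table, cell by cell, followed by an end marker. -/
def encodeRow {m : ℕ} (r : Fin m → Bool) : List Letter :=
  (List.ofFn fun j => if r j = true then Letter.cross else Letter.blank) ++ [Letter.endRow]

/-- A cross-table, row by row, followed by an end marker. -/
def encodeTable {m : ℕ} (rows : List (Fin m → Bool)) : List Letter :=
  rows.flatMap encodeRow ++ [Letter.endTable]

/-- A list of attribute sets, as the cross-table whose rows are their characteristic functions. -/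
def encodeSets {m : ℕ} (L : List (Finset (Fin m))) : List Letter :=
  encodeTable (L.map fun S j => decide (j ∈ S))

/-- A pair of contexts: a full row of length `|M|`, then both cross-tables. -/
def encodePair (K : ContextPair) : List Letter :=
  encodeRow (fun _ : K.Attr => true) ++
    encodeTable (List.ofFn K.posTable) ++ encodeTable (List.ofFn K.negTable)

/-- An instance of `AMH`: the pair of contexts, then the list of given minimal hypotheses. -/
def encodeAMH (x : AMHInstance) : List Letter :=
  encodePair x.toContextPair ++ encodeSets x.known

/-- `w` is a correct output for the minimal hypotheses enumeration problem on input `K`: it is a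
list of all minimal hypotheses (and nothing else), each listed exactly once. -/
def MHE (K : ContextPair) (w : List Letter) : Prop :=
  ∃ L : List (Finset K.Attr),
    L.Nodup ∧ (∀ H, H ∈ L ↔ K.IsMinimalHypothesis H) ∧ w = encodeSets L

/-! ### Time bounds, for multi-stack Turing machines -/

open Classical in
/-- The decision problem with instances `a : α`, encoded by `enc`, and question `Q` is in P. -/
def InP {α Γ : Type} (enc : α → List Γ) (Q : α → Prop) : Prop :=
  Nonempty (Turing.TM2ComputableInPolyTime enc Computability.encodeBool fun a => decide (Q a))

/-- The problem to find, on input `a : α`, encoded by `enc`, some output word `w` with `R a w` can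
be solved in output-polynomial time: some machine halts on each input `a` with such a `w`, within a
number of steps polynomial in the length of the input and the length of the output `w`. -/
def SolvableInOutputPolyTime {α Γ Δ : Type} (enc : α → List Γ) (R : α → List Δ → Prop) : Prop :=
  ∃ (c : Turing.TM2ComputableAux Γ Δ) (p : Polynomial ℕ), ∀ a : α, ∃ w : List Δ, R a w ∧
    Nonempty (Turing.TM2OutputsInTime c.tm ((enc a).map c.inputAlphabet.invFun)
      (some (w.map c.outputAlphabet.invFun)) (p.eval ((enc a).length + w.length)))

end HypothesisEnumeration

/-!
A machine for one of the two problems is turned into a machine for the other. The new machine has the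
work tapes of the given one, one stack of Booleans and finitely many stacks of letters; its program
is put together from sequences, conditionals and loops (`Frag`, `Frag.Runs`), and runs the given
machine as a subprogram (`Frag.runs_simulate`, `Frag.reach_simulateFor`).

Suppose that minimal hypotheses can be enumerated within a time `p (n + s)`, where `n` and `s` are the
lengths of the input and of the output. To answer the question of `AMH`, run the enumeration on the
two contexts for as many steps as `p` allows if the output is not longer than the list of the known
minimal hypotheses. If it does not halt in time, then its output must be longer than this list, and so
there is a further minimal hypothesis. If it does halt, it is enough to compare the lengths, because
all rows of the output have the same length and because the known minimal hypotheses are listed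
without repetition (`Frag.runs_amhProg`, `inP_AMH_of_solvable_MHE`).

Suppose conversely that `AMH` is in P. Minimal hypotheses are found one by one. Let `T` be an intent
of the positive context which is `M`, or contained in no negative example. Replace the positive rows
by their intersections with `T`, and add `T` and the known minimal hypotheses as further rows. The
minimal hypotheses of the new contexts are the known ones and those that are contained in `T`
(`rowMinHyp_auxRows_iff`). So a question for these contexts tells if there is a further minimal
hypothesis contained in `T` (`HasNew`, `Frag.runs_ask`). Start with `S = M`, and for each positive row
`R` in turn replace `S` by `S ∩ R` if this still contains a further minimal hypothesis (`shrink`). In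
the end `S` contains some further minimal hypothesis `H` and is contained in each positive row that
contains `H`; since `H` is an intersection of positive rows, `S = H` (`foldl_shrink_spec`). Each
minimal hypothesis thus costs one question more than there are positive rows, and the length of a
question is linear in the lengths of the input and of the output (`Frag.runs_search`,
`Frag.runs_search_loop`, `solvable_MHE_of_inP_AMH`).
-/

namespace HypothesisEnumeration

open Turing Function

/-! ### Program fragments for stack machines -/

section Fragments

variable {K : Type} {Γ : K → Type} {σ : Type}

/-- Rename the labels of a statement. -/
def mapLabel {Λ Λ' : Type} (g : Λ → Λ') : TM2.Stmt Γ Λ σ → TM2.Stmt Γ Λ' σ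
  | .push k f q => .push k f (mapLabel g q)
  | .peek k f q => .peek k f (mapLabel g q)
  | .pop k f q => .pop k f (mapLabel g q)
  | .load f q => .load f (mapLabel g q)
  | .branch f q₁ q₂ => .branch f (mapLabel g q₁) (mapLabel g q₂)
  | .goto f => .goto fun v => g (f v)
  | .halt => .halt

variable [DecidableEq K]

theorem stepAux_mapLabel {Λ Λ' : Type} (g : Λ → Λ') (q : TM2.Stmt Γ Λ σ) (v : σ)
    (S : ∀ k, List (Γ k)) :
    TM2.stepAux (mapLabel g q) v S =
      ⟨(TM2.stepAux q v S).l.map g, (TM2.stepAux q v S).var, (TM2.stepAux q v S).stk⟩ := by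
  induction q generalizing v S with
  | branch f q₁ q₂ h₁ h₂ => cases h : f v <;> simp [mapLabel, h, h₁, h₂]
  | _ => simp_all [mapLabel]

variable (Γ σ) in
/-- A piece of a program for a stack machine: finitely many labelled statements, one of which is the
entry point. The label `none` stands for the exit, where control is passed on. -/
structure Frag where
  /-- the labels -/
  Λ : Type
  /-- there are finitely many labels -/
  fin : Fintype Λ
  /-- the entry point -/
  entry : Λ
  /-- the statements -/
  code : Λ → TM2.Stmt Γ (Option Λ) σ

namespace Frag

/-- `F.Reach o v S n v' S'`: started at the label `o` with state `v` and stacks `S`, the fragment `F`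
arrives at its exit after exactly `n` steps, with state `v'` and stacks `S'`. -/
inductive Reach (F : Frag Γ σ) :
    Option F.Λ → σ → (∀ k, List (Γ k)) → ℕ → σ → (∀ k, List (Γ k)) → Prop
  | exit (v S) : Reach F none v S 0 v S
  | step {l v S o v₁ S₁ n v₂ S₂} : TM2.stepAux (F.code l) v S = ⟨some o, v₁, S₁⟩ →
      Reach F o v₁ S₁ n v₂ S₂ → Reach F (some l) v S (n + 1) v₂ S₂

/-- If the code of `F` occurs inside `H`, with the exit of `F` redirected to the label `e`, then runs
of `F` are segments of runs of `H`. -/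
theorem Reach.embed {F H : Frag Γ σ} (i : F.Λ → H.Λ) (e : Option H.Λ)
    (hi : ∀ l, H.code (i l) = mapLabel (fun o => o.elim e fun l => some (i l)) (F.code l))
    {o v S n v₁ S₁ n' v₂ S₂} (h : F.Reach o v S n v₁ S₁) (h' : H.Reach e v₁ S₁ n' v₂ S₂) :
    H.Reach (o.elim e fun l => some (i l)) v S (n + n') v₂ S₂ := by
  induction h with
  | exit => simpa using h'
  | step hs _ ih =>
    rw [Nat.add_right_comm]
    refine .step ?_ (ih h')
    rw [hi, stepAux_mapLabel, hs]
    rfl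

/-- A single statement. Its `goto`s lead to the exit. -/
def single (q : TM2.Stmt Γ (Option Unit) σ) : Frag Γ σ := ⟨Unit, inferInstance, (), fun _ => q⟩

/-- Sequential composition. -/
def seq (F G : Frag Γ σ) : Frag Γ σ where
  Λ := F.Λ ⊕ G.Λ
  fin := haveI := F.fin; haveI := G.fin; inferInstance
  entry := .inl F.entry
  code
    | .inl l => mapLabel (fun o => o.elim (some (.inr G.entry)) fun l => some (.inl l)) (F.code l)
    | .inr l => mapLabel (fun o => o.elim none fun l => some (.inr l)) (G.code l)

/-- Conditional execution. -/
def cond (c : σ → Bool) (F G : Frag Γ σ) : Frag Γ σ where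
  Λ := Option (F.Λ ⊕ G.Λ)
  fin := haveI := F.fin; haveI := G.fin; inferInstance
  entry := none
  code
    | none => .branch c (.goto fun _ => some (some (.inl F.entry)))
        (.goto fun _ => some (some (.inr G.entry)))
    | some (.inl l) => mapLabel (fun o => o.elim none fun l => some (some (.inl l))) (F.code l)
    | some (.inr l) => mapLabel (fun o => o.elim none fun l => some (some (.inr l))) (G.code l)

/-- Loop: run `F` as long as the state satisfies `c`. -/
def loop (c : σ → Bool) (F : Frag Γ σ) : Frag Γ σ where
  Λ := Option F.Λ
  fin := haveI := F.fin; inferInstance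
  entry := none
  code
    | none => .branch c (.goto fun _ => some (some F.entry)) (.goto fun _ => none)
    | some l => mapLabel (fun o => o.elim (some none) fun l => some (some l)) (F.code l)

theorem Reach.seq {F G : Frag Γ σ} {v S n v₁ S₁ n' v₂ S₂}
    (h : F.Reach (some F.entry) v S n v₁ S₁) (h' : G.Reach (some G.entry) v₁ S₁ n' v₂ S₂) :
    (F.seq G).Reach (some (F.seq G).entry) v S (n + n') v₂ S₂ := by
  have h₂ := h'.embed (H := F.seq G) Sum.inr none (fun _ => rfl) (.exit _ _)
  exact h.embed (H := F.seq G) Sum.inl _ (fun _ => rfl) h₂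

theorem Reach.cond_true {c : σ → Bool} {F G : Frag Γ σ} {v S n v₁ S₁} (hc : c v = true)
    (h : F.Reach (some F.entry) v S n v₁ S₁) :
    (F.cond c G).Reach (some (F.cond c G).entry) v S (n + 1) v₁ S₁ := by
  have h₂ := h.embed (H := cond c F G) (fun l => some (.inl l)) none (fun _ => rfl) (.exit _ _)
  exact .step (by simp [Frag.cond, hc]) h₂

theorem Reach.cond_false {c : σ → Bool} {F G : Frag Γ σ} {v S n v₁ S₁} (hc : c v = false)
    (h : G.Reach (some G.entry) v S n v₁ S₁) :
    (F.cond c G).Reach (some (F.cond c G).entry) v S (n + 1) v₁ S₁ := by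
  have h₂ := h.embed (H := cond c F G) (fun l => some (.inr l)) none (fun _ => rfl) (.exit _ _)
  exact .step (by simp [Frag.cond, hc]) h₂

theorem Reach.loop_false {c : σ → Bool} {F : Frag Γ σ} {v S} (hc : c v = false) :
    (F.loop c).Reach (some (F.loop c).entry) v S 1 v S :=
  .step (by simp [Frag.loop, hc]) (.exit _ _)

theorem Reach.loop_true {c : σ → Bool} {F : Frag Γ σ} {v S n v₁ S₁ n' v₂ S₂} (hc : c v = true)
    (h : F.Reach (some F.entry) v S n v₁ S₁)
    (h' : (F.loop c).Reach (some (F.loop c).entry) v₁ S₁ n' v₂ S₂) :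
    (F.loop c).Reach (some (F.loop c).entry) v S (n + n' + 1) v₂ S₂ := by
  have h₂ := h.embed (H := loop c F) some (some none) (fun _ => rfl) h'
  exact .step (by simp [Frag.loop, hc]) h₂

/-- The machine that runs a fragment and halts at its exit, with input stack `k₀`, output stack `k₁`
and initial state `v`. -/
def toFinTM2 [Fintype K] [Fintype σ] (F : Frag Γ σ) (k₀ k₁ : K) [Fintype (Γ k₀)] (v : σ) :
    FinTM2 :=
  haveI := F.fin
  { K := K
    k₀ := k₀
    k₁ := k₁
    Γ := Γ
    Λ := Option F.Λ
    main := some F.entry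
    σ := σ
    initialState := v
    m := fun o => o.elim .halt F.code }

end Frag

end Fragments

theorem initList_eq (tm : FinTM2) (l : List (tm.Γ tm.k₀)) :
    initList tm l = ⟨some tm.main, tm.initialState, update (fun _ => []) tm.k₀ l⟩ := by
  unfold initList
  congr 1
  funext k
  by_cases h : k = tm.k₀
  · subst h; simp
  · simp [h]

theorem haltList_eq (tm : FinTM2) (l : List (tm.Γ tm.k₁)) :
    haltList tm l = ⟨none, tm.initialState, update (fun _ => []) tm.k₁ l⟩ := by
  unfold haltList
  congr 1
  funext k
  by_cases h : k = tm.k₁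
  · subst h; simp
  · simp [h]

theorem Frag.Reach.iterate {K : Type} {Γ : K → Type} {σ : Type} [DecidableEq K] [Fintype K]
    [Fintype σ] {F : Frag Γ σ} {k₀ k₁ : K} [Fintype (Γ k₀)] {v₀ : σ} {o v S n v₁ S₁}
    (h : F.Reach o v S n v₁ S₁) :
    (flip bind (F.toFinTM2 k₀ k₁ v₀).step)^[n + 1]
      (some (⟨some o, v, S⟩ : (F.toFinTM2 k₀ k₁ v₀).Cfg)) = some ⟨none, v₁, S₁⟩ := by
  induction h with
  | exit => rfl
  | step hs _ ih =>
    rw [iterate_succ_apply, ← ih]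
    congr 1
    exact congrArg some hs

/-- A run of a fragment from the initial to the final configuration gives a computation of the
machine. -/
theorem Frag.Reach.outputs {K : Type} {Γ : K → Type} {σ : Type} [DecidableEq K] [Fintype K]
    [Fintype σ] {F : Frag Γ σ} {k₀ k₁ : K} [Fintype (Γ k₀)] {v₀ : σ} {l l' n m}
    (h : F.Reach (some F.entry) v₀ (update (fun _ => []) k₀ l) n v₀ (update (fun _ => []) k₁ l'))
    (hn : n + 1 ≤ m) :
    Nonempty (TM2OutputsInTime (F.toFinTM2 k₀ k₁ v₀) (l.map (Equiv.refl (Γ k₀)).invFun)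
      (some (l'.map (Equiv.refl (Γ k₁)).invFun)) m) := by
  have e₀ : l.map (Equiv.refl (Γ k₀)).invFun = l := List.map_id l
  have e₁ : l'.map (Equiv.refl (Γ k₁)).invFun = l' := List.map_id l'
  have key : ∀ x y, x = l → y = l' →
      Nonempty (TM2OutputsInTime (F.toFinTM2 k₀ k₁ v₀) x (some y) m) := by
    rintro l l' rfl rfl
    have h₀ := initList_eq (F.toFinTM2 k₀ k₁ v₀) l
    have h₁ := haltList_eq (F.toFinTM2 k₀ k₁ v₀) l'
    exact ⟨⟨⟨n + 1, (congrArg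
      (fun c => (flip bind (F.toFinTM2 k₀ k₁ v₀).step)^[n + 1] (some c)) h₀).trans
      (h.iterate.trans (congrArg some h₁.symm))⟩, hn⟩⟩
  exact key _ _ e₀ e₁

/-! ### Programs with letter variables and a simulated machine -/

instance : Fintype Letter where
  elems := {.cross, .blank, .endRow, .endTable}
  complete x := by cases x <;> simp

/-- The registers of a program: two letters and three flags. -/
structure Reg where
  /-- the letter read last from the stack that controls a loop -/
  cur : Option Letter
  /-- an auxiliary letter -/
  aux : Option Letter
  /-- a flag for the comparison of two rows -/
  sub : Bool
  /-- a flag for the comparison of a row with a table -/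
  bad : Bool
  /-- the answer to a question -/
  ans : Bool
  deriving Fintype

/-- The initial values of the registers. -/
def Reg.init : Reg := ⟨none, none, false, false, false⟩

/-- The letter read last, with a junk value if the stack was empty. -/
def Reg.letter (r : Reg) : Letter := r.cur.getD .cross

/-- Change the letter read last. -/
@[simps]
def Reg.setCur (r : Reg) (o : Option Letter) : Reg := { r with cur := o }

@[simp]
theorem Reg.setCur_setCur (r : Reg) (o o' : Option Letter) :
    (r.setCur o).setCur o' = r.setCur o' := rfl

@[simp]
theorem Reg.letter_setCur (r : Reg) (a : Letter) : (r.setCur (some a)).letter = a := rfl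

/-- The stacks of a program: those of a simulated machine `tm`, a stack of Booleans, and a stack of
letters for each of the variables `x : W`. -/
abbrev StackIndex (tm : FinTM2) (W : Type) : Type := tm.K ⊕ Option W

/-- The alphabets of the stacks of a program. -/
abbrev StackAlphabet (tm : FinTM2) (W : Type) : StackIndex tm W → Type
  | .inl k => tm.Γ k
  | .inr none => Bool
  | .inr (some _) => Letter

/-- Program fragments with letter variables `x : W` which simulate the machine `tm`. -/
abbrev Prog (tm : FinTM2) (W : Type) : Type 1 := Frag (StackAlphabet tm W) (tm.σ × Reg)

/-- A state of the memory of a program. -/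
@[ext]
structure Mem (tm : FinTM2) (W : Type) where
  /-- the internal state of the simulated machine -/
  q : tm.σ
  /-- the stacks of the simulated machine -/
  s : ∀ k, List (tm.Γ k)
  /-- the stack of Booleans -/
  b : List Bool
  /-- the registers -/
  r : Reg
  /-- the values of the letter variables -/
  w : W → List Letter

section Programs

variable {tm : FinTM2} {W : Type}

/-- All stacks of a program, given by their three groups. -/
def stackFun (s : ∀ k, List (tm.Γ k)) (b : List Bool) (w : W → List Letter) :
    ∀ k, List (StackAlphabet tm W k)
  | .inl k => s k
  | .inr none => b
  | .inr (some x) => w x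

theorem stackFun_nil :
    stackFun (tm := tm) (W := W) (fun _ => []) [] (fun _ => []) = fun _ => [] := by
  funext k
  rcases k with k | _ | k <;> rfl

variable [DecidableEq W]

theorem update_stacks_inl (s : ∀ k, List (tm.Γ k)) (b : List Bool) (w : W → List Letter)
    (k : tm.K) (l : List (tm.Γ k)) :
    update (stackFun s b w) (.inl k) l = stackFun (update s k l) b w := by
  funext j
  rcases j with j | _ | j
  · by_cases h : j = k
    · subst h; simp [stackFun]
    · simp [stackFun, h]
  · rfl
  · rfl

theorem update_stacks_none (s : ∀ k, List (tm.Γ k)) (b : List Bool) (w : W → List Letter)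
    (l : List Bool) : update (stackFun s b w) (.inr none) l = stackFun s l w := by
  funext j
  rcases j with j | _ | j <;> simp [stackFun]

theorem update_stacks_some (s : ∀ k, List (tm.Γ k)) (b : List Bool) (w : W → List Letter)
    (x : W) (l : List Letter) :
    update (stackFun s b w) (.inr (some x)) l = stackFun s b (update w x l) := by
  funext j
  rcases j with j | _ | j
  · rfl
  · simp [stackFun]
  · by_cases h : j = x
    · subst h; simp [stackFun]
    · simp [stackFun, h]

theorem stackFun_single_some (x : W) (l : List Letter) :
    stackFun (tm := tm) (fun _ => []) [] (update (fun _ => []) x l) =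
      update (β := fun k => List (StackAlphabet tm W k)) (fun _ => []) (.inr (some x)) l := by
  rw [← stackFun_nil, update_stacks_some]

theorem stackFun_single_none (l : List Bool) :
    stackFun (tm := tm) (W := W) (fun _ => []) l (fun _ => []) =
      update (β := fun k => List (StackAlphabet tm W k)) (fun _ => []) (.inr none) l := by
  rw [← stackFun_nil, update_stacks_none]

/-- `F.Runs t a b`: started with memory `a`, the program `F` arrives at its exit within `t` steps,
with memory `b`. -/
def Frag.Runs (F : Prog tm W) (t : ℕ) (a b : Mem tm W) : Prop :=
  ∃ n ≤ t, F.Reach (some F.entry) (a.q, a.r) (stackFun a.s a.b a.w) n (b.q, b.r) (stackFun b.s b.b b.w)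

namespace Frag

theorem Runs.congr {F : Prog tm W} {t t' : ℕ} {a b b' : Mem tm W} (h : F.Runs t a b)
    (hb : b = b') (ht : t ≤ t') : F.Runs t' a b' := by
  subst hb
  obtain ⟨n, hn, h⟩ := h
  exact ⟨n, hn.trans ht, h⟩

theorem Runs.seq {F G : Prog tm W} {t t' : ℕ} {a b c : Mem tm W} (h : F.Runs t a b)
    (h' : G.Runs t' b c) : (F.seq G).Runs (t + t') a c := by
  obtain ⟨n, hn, h⟩ := h
  obtain ⟨n', hn', h'⟩ := h'
  exact ⟨n + n', Nat.add_le_add hn hn', h.seq h'⟩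

/-- Conditional execution, depending on the registers. -/
def ite (c : Reg → Bool) (F G : Prog tm W) : Prog tm W := Frag.cond (fun v => c v.2) F G

/-- Loop, depending on the registers. -/
def whileDo (c : Reg → Bool) (F : Prog tm W) : Prog tm W := Frag.loop (fun v => c v.2) F

theorem Runs.ite_true {c : Reg → Bool} {F G : Prog tm W} {t : ℕ} {a b : Mem tm W}
    (hc : c a.r = true) (h : F.Runs t a b) : (ite c F G).Runs (t + 1) a b := by
  obtain ⟨n, hn, h⟩ := h
  exact ⟨n + 1, by omega, h.cond_true hc⟩

theorem Runs.ite_false {c : Reg → Bool} {F G : Prog tm W} {t : ℕ} {a b : Mem tm W}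
    (hc : c a.r = false) (h : G.Runs t a b) : (ite c F G).Runs (t + 1) a b := by
  obtain ⟨n, hn, h⟩ := h
  exact ⟨n + 1, by omega, h.cond_false hc⟩

theorem runs_whileDo_false {c : Reg → Bool} {F : Prog tm W} {a : Mem tm W}
    (hc : c a.r = false) : (F.whileDo c).Runs 1 a a :=
  ⟨1, le_rfl, Reach.loop_false hc⟩

theorem Runs.whileDo_true {c : Reg → Bool} {F : Prog tm W} {t t' : ℕ} {a b d : Mem tm W}
    (hc : c a.r = true) (h : F.Runs t a b) (h' : (F.whileDo c).Runs t' b d) :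
    (F.whileDo c).Runs (t + t' + 1) a d := by
  obtain ⟨n, hn, h⟩ := h
  obtain ⟨n', hn', h'⟩ := h'
  exact ⟨n + n' + 1, by omega, Reach.loop_true hc h h'⟩

theorem runs_single {q : TM2.Stmt (StackAlphabet tm W) (Option Unit) (tm.σ × Reg)} {a b : Mem tm W}
    (h : TM2.stepAux q (a.q, a.r) (stackFun a.s a.b a.w) =
      ⟨some none, (b.q, b.r), stackFun b.s b.b b.w⟩) : (single q).Runs 1 a b :=
  ⟨1, le_rfl, .step h (.exit _ _)⟩

/-- Pop a letter from the variable `x` into the registers. -/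
def pop (x : W) (f : Reg → Option Letter → Reg) : Prog tm W :=
  single (.pop (.inr (some x)) (fun v o => (v.1, f v.2 o)) (.goto fun _ => none))

theorem runs_pop (x : W) (f : Reg → Option Letter → Reg) (m : Mem tm W) :
    (pop x f).Runs 1 m { m with r := f m.r (m.w x).head?, w := update m.w x (m.w x).tail } :=
  runs_single (by simp [update_stacks_some, stackFun])

/-- Read the first letter of the variable `x` into the registers. -/
def peek (x : W) (f : Reg → Option Letter → Reg) : Prog tm W :=
  single (.peek (.inr (some x)) (fun v o => (v.1, f v.2 o)) (.goto fun _ => none))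

theorem runs_peek (x : W) (f : Reg → Option Letter → Reg) (m : Mem tm W) :
    (peek x f).Runs 1 m { m with r := f m.r (m.w x).head? } :=
  runs_single (by simp [stackFun])

/-- Push a letter, determined by the registers, on the variable `x`. -/
def push (x : W) (f : Reg → Letter) : Prog tm W :=
  single (.push (.inr (some x)) (fun v => f v.2) (.goto fun _ => none))

theorem runs_push (x : W) (f : Reg → Letter) (m : Mem tm W) :
    (push x f).Runs 1 m { m with w := update m.w x (f m.r :: m.w x) } :=
  runs_single (by simp [update_stacks_some, stackFun])

/-- Change the registers. -/
def set (f : Reg → Reg) : Prog tm W :=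
  single (.load (fun v => (v.1, f v.2)) (.goto fun _ => none))

theorem runs_set (f : Reg → Reg) (m : Mem tm W) :
    (set f).Runs 1 m { m with r := f m.r } :=
  runs_single (by simp)

/-- Pop a letter from `x` into the register `cur`. -/
def popCur (x : W) : Prog tm W := pop x Reg.setCur

theorem runs_popCur (x : W) (m : Mem tm W) :
    (popCur x).Runs 1 m
      { m with r := m.r.setCur (m.w x).head?, w := update m.w x (m.w x).tail } :=
  runs_pop ..

/-- Run `F` for each letter of the variable `x`, which is emptied. -/
def forEach (x : W) (F : Prog tm W) : Prog tm W :=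
  (popCur x).seq (whileDo (fun r => r.cur.isSome) (F.seq (popCur x)))

/-- The rule for `forEach`: if `G m` is, for a memory `m` before a pass, the memory after the last
pass, then `forEach` leads from `m` to `G m`. -/
theorem runs_forEach {x : W} {F : Prog tm W} (P : Mem tm W → Prop) (G : Mem tm W → Mem tm W)
    (c : ℕ) (h₀ : ∀ m, P m → m.w x = [] → G m = { m with r := m.r.setCur none })
    (hF : ∀ m a l, P m → m.w x = a :: l → ∃ m',
      F.Runs c { m with r := m.r.setCur (some a), w := update m.w x l } m' ∧
        m'.w x = l ∧ P m' ∧ G m' = G m) (m : Mem tm W) (hm : P m) :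
    (forEach x F).Runs ((c + 2) * (m.w x).length + 2) m (G m) := by
  have key : ∀ l m, P m → m.w x = l →
      (whileDo (fun r => r.cur.isSome) (F.seq (popCur x))).Runs ((c + 2) * l.length + 1)
        { m with r := m.r.setCur l.head?, w := update m.w x l.tail } (G m) := by
    intro l
    induction l with
    | nil =>
      intro m hm hl
      rw [h₀ m hm hl]
      refine (runs_whileDo_false (by rfl)).congr ?_ (by simp)
      simp [hl]
    | cons a l ih =>
      intro m hm hl
      obtain ⟨m', h₁, h₂, h₃, h₄⟩ := hF m a l hm hl
      have h₅ := ih m' h₃ h₂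
      rw [h₄, ← h₂] at h₅
      refine (Runs.whileDo_true (by rfl) (h₁.seq (runs_popCur x m')) h₅).congr rfl ?_
      rw [h₂, List.length_cons]
      ring_nf
      omega
  refine ((runs_popCur x m).seq (key _ m hm rfl)).congr rfl (by omega)

/-- Empty the variable `x`. -/
def clear (x : W) : Prog tm W := forEach x (set id)

theorem runs_clear (x : W) (m : Mem tm W) :
    (clear x).Runs (3 * (m.w x).length + 2) m
      { m with r := m.r.setCur none, w := update m.w x [] } := by
  refine runs_forEach (fun _ => True) (fun m => { m with r := m.r.setCur none, w := update m.w x [] }) 1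
    ?_ ?_ m trivial
  · intro m _ h
    simp [h]
  · intro m a l _ h
    exact ⟨_, runs_set .., by simp⟩

/-- Move the letters of `x` to `y`, which reverses their order. -/
def move (x y : W) : Prog tm W := forEach x (push y Reg.letter)

theorem runs_move {x y : W} (hxy : x ≠ y) (m : Mem tm W) :
    (move x y).Runs (3 * (m.w x).length + 2) m
      { m with
        r := m.r.setCur none
        w := update (update m.w x []) y ((m.w x).reverse ++ m.w y) } := by
  refine runs_forEach (fun _ => True) (fun m => { m with
        r := m.r.setCur none
        w := update (update m.w x []) y ((m.w x).reverse ++ m.w y) }) 1 ?_ ?_ m trivial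
  · intro m _ h
    have e : update m.w x [] = m.w := by rw [← h]; simp
    simp [h, e]
  · intro m a l _ h
    refine ⟨_, runs_push .., by simp [hxy], trivial, ?_⟩
    simp [h, hxy, hxy.symm, update_comm hxy]

/-- Put a copy of the value of `x` in front of that of `y`, where `z` is used as scratch. -/
def prepend (x y z : W) : Prog tm W :=
  (move x z).seq (forEach z ((push x Reg.letter).seq (push y Reg.letter)))

theorem runs_prepend {x y z : W} (hxy : x ≠ y) (hxz : x ≠ z) (hyz : y ≠ z) (m : Mem tm W)
    (hz : m.w z = []) :
    (prepend x y z).Runs (7 * (m.w x).length + 4) m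
      { m with r := m.r.setCur none, w := update m.w y (m.w x ++ m.w y) } := by
  have h := runs_forEach (tm := tm) (x := z) (F := (push x Reg.letter).seq (push y Reg.letter))
    (fun _ => True)
    (fun m => { m with
        r := m.r.setCur none
        w := update (update (update m.w z []) x ((m.w z).reverse ++ m.w x)) y
          ((m.w z).reverse ++ m.w y) }) 2
    (by
      intro m _ h
      have e : update m.w z [] = m.w := by rw [← h]; simp
      simp [h, e])
    (by
      intro m a l _ h
      refine ⟨_, (runs_push ..).seq (runs_push ..), by simp [hxz.symm, hyz.symm], trivial, ?_⟩
      ext1 <;> try rfl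
      funext j
      by_cases h₁ : j = y
      · simp [h₁, h, hxy.symm, hxz.symm, hyz, hyz.symm]
      by_cases h₂ : j = x
      · simp [h₂, h, hxy, hxz, hxz.symm, hyz.symm]
      by_cases h₃ : j = z <;> simp [h₁, h₂, h₃, hxz, hxz.symm, hyz.symm])
  refine ((runs_move hxz m).seq (h _ trivial)).congr ?_ ?_
  · ext1 <;> try rfl
    funext j
    by_cases h₁ : j = y
    · simp [h₁, hxy.symm, hyz, hz]
    by_cases h₂ : j = x
    · simp [h₂, hxy, hxz, hz]
    by_cases h₃ : j = z <;> simp [h₁, h₂, h₃, hz, hxz, hyz, hxz.symm, hyz.symm]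
  · simp [hz]; omega

/-- Move the letters of `x` up to the first letter `c` to `y`, and delete this letter `c`. -/
def takeUntil (c : Letter) (x y : W) : Prog tm W :=
  (popCur x).seq ((whileDo (fun r => decide (r.cur ≠ some c))
    ((push y Reg.letter).seq (popCur x))).seq (set fun r => r.setCur none))

theorem runs_takeUntil {c : Letter} {x y : W} (hxy : x ≠ y) (m : Mem tm W) (l l' : List Letter)
    (hm : m.w x = l ++ c :: l') (hl : c ∉ l) :
    (takeUntil c x y).Runs (3 * l.length + 3) m
      { m with r := m.r.setCur none, w := update (update m.w x l') y (l.reverse ++ m.w y) } := by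
  have key : ∀ (l : List Letter) (m : Mem tm W), m.w x = l ++ c :: l' → c ∉ l →
      (whileDo (fun r => decide (r.cur ≠ some c)) ((push y Reg.letter).seq (popCur x))).Runs
        (3 * l.length + 1)
        { m with r := m.r.setCur (m.w x).head?, w := update m.w x (m.w x).tail }
        { m with r := m.r.setCur (some c), w := update (update m.w x l') y (l.reverse ++ m.w y) } := by
    intro l
    induction l with
    | nil =>
      intro m hm _
      refine (runs_whileDo_false (by simp [hm])).congr ?_ (by simp)
      simp [hm, hxy.symm]
    | cons a l ih =>
      intro m hm hl
      simp only [List.mem_cons, not_or] at hl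
      have h₁ := ih { m with w := update (update m.w x (l ++ c :: l')) y (a :: m.w y) }
        (by simp [hxy]) hl.2
      have h₂ := (runs_push y Reg.letter
        { m with r := m.r.setCur (some a), w := update m.w x (l ++ c :: l') }).seq (runs_popCur x _)
      simp only [Reg.letter_setCur, Reg.setCur_setCur, ne_eq, hxy, hxy.symm, not_false_eq_true,
        update_of_ne, update_self] at h₁ h₂
      rw [hm]
      refine (Runs.whileDo_true (by simp [Ne.symm hl.1]) h₂ h₁).congr ?_ ?_
      · simp [update_comm hxy]
      · simp; omega
  refine ((runs_popCur x m).seq ((key l m hm hl).seq (runs_set ..))).congr rfl (by omega)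

end Frag

end Programs

/-! ### Simulating a machine inside a program -/

section Simulation

variable {tm : FinTM2} {W : Type}

/-- Set the flag for the answer. -/
@[simps]
def Reg.setAns (r : Reg) (b : Bool) : Reg := { r with ans := b }

/-- The statements of the simulated machine, as statements of the simulating program. Where the
machine halts, the program passes to its exit and sets the flag `ans`. -/
def liftStmt : TM2.Stmt tm.Γ tm.Λ tm.σ →
    TM2.Stmt (StackAlphabet tm W) (Option tm.Λ) (tm.σ × Reg)
  | .push k f q => .push (.inl k) (fun v => f v.1) (liftStmt q)
  | .peek k f q => .peek (.inl k) (fun v o => (f v.1 o, v.2)) (liftStmt q)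
  | .pop k f q => .pop (.inl k) (fun v o => (f v.1 o, v.2)) (liftStmt q)
  | .load f q => .load (fun v => (f v.1, v.2)) (liftStmt q)
  | .branch f q₁ q₂ => .branch (fun v => f v.1) (liftStmt q₁) (liftStmt q₂)
  | .goto f => .goto fun v => some (f v.1)
  | .halt => .load (fun v => (v.1, v.2.setAns true)) (.goto fun _ => none)

/-- The number of `push` instructions in a statement. -/
def pushCount {K : Type} {Γ : K → Type} {Λ σ : Type} : TM2.Stmt Γ Λ σ → ℕ
  | .push _ _ q => pushCount q + 1
  | .peek _ _ q => pushCount q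
  | .pop _ _ q => pushCount q
  | .load _ q => pushCount q
  | .branch _ q₁ q₂ => pushCount q₁ + pushCount q₂
  | .goto _ => 0
  | .halt => 0

theorem length_stepAux_le {K : Type} [DecidableEq K] {Γ : K → Type} {Λ σ : Type}
    (q : TM2.Stmt Γ Λ σ) (v : σ) (S : ∀ k, List (Γ k)) (k : K) :
    ((TM2.stepAux q v S).stk k).length ≤ (S k).length + pushCount q := by
  induction q generalizing v S with
  | push k' f q ih =>
    refine (ih _ _).trans ?_
    by_cases h : k = k'
    · subst h; simp [pushCount]; omega
    · simp [pushCount, h]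
  | peek k' f q ih => exact ih _ _
  | pop k' f q ih =>
    refine (ih _ _).trans ?_
    by_cases h : k = k'
    · subst h; simp [pushCount]
    · simp [pushCount, h]
  | load f q ih => exact ih _ _
  | branch f q₁ q₂ h₁ h₂ =>
    cases h : f v
    · simpa [h, pushCount] using (h₂ v S).trans (by omega)
    · simpa [h, pushCount] using (h₁ v S).trans (by omega)
  | goto => simp [pushCount]
  | halt => simp [pushCount]

/-- A bound on the number of letters that a machine pushes in a single step. -/
def maxPush (tm : FinTM2) : ℕ :=
  haveI := tm.ΛFin
  ∑ l, pushCount (tm.m l)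

theorem pushCount_le_maxPush (tm : FinTM2) (l : tm.Λ) : pushCount (tm.m l) ≤ maxPush tm :=
  Finset.single_le_sum (f := fun l => pushCount (tm.m l)) (fun _ _ => Nat.zero_le _)
    (@Finset.mem_univ _ tm.ΛFin l)

variable [DecidableEq W]

theorem stepAux_liftStmt (q : TM2.Stmt tm.Γ tm.Λ tm.σ) (v : tm.σ) (r : Reg)
    (s : ∀ k, List (tm.Γ k)) (b : List Bool) (w : W → List Letter) :
    TM2.stepAux (liftStmt q) (v, r) (stackFun s b w) =
      ⟨some (TM2.stepAux q v s).l, ((TM2.stepAux q v s).var,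
        bif (TM2.stepAux q v s).l.isSome then r else r.setAns true),
        stackFun (TM2.stepAux q v s).stk b w⟩ := by
  induction q generalizing v s with
  | push k f q ih => simp [liftStmt, update_stacks_inl, ← ih, stackFun]
  | pop k f q ih => simp [liftStmt, update_stacks_inl, ← ih, stackFun]
  | branch f q₁ q₂ h₁ h₂ => cases h : f v <;> simp [liftStmt, h, h₁, h₂]
  | peek k f q ih => simp [liftStmt, ← ih, stackFun]
  | load f q ih => simp [liftStmt, ← ih]
  | goto => simp [liftStmt]
  | halt => simp [liftStmt]

/-- One step at the head of an iteration that does not get stuck. -/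
theorem exists_step_of_iterate_succ {tm : FinTM2} {n : ℕ} {c c' : tm.Cfg}
    (h : (flip bind tm.step)^[n + 1] (some c) = some c') :
    ∃ l, c.l = some l ∧
      (flip bind tm.step)^[n] (some (TM2.stepAux (tm.m l) c.var c.stk)) = some c' := by
  have hnone : ∀ n, (flip bind tm.step)^[n] none = none := by
    intro n
    induction n with
    | zero => rfl
    | succ n ih => rw [iterate_succ_apply]; exact ih
  obtain ⟨_ | l, v, S⟩ := c
  · rw [iterate_succ_apply] at h
    have h' : (flip bind tm.step)^[n] none = some c' := h
    rw [hnone] at h'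
    cases h'
  · exact ⟨l, rfl, h⟩

namespace Frag

/-- Run the simulated machine. -/
def simulate (tm : FinTM2) (W : Type) : Prog tm W where
  Λ := tm.Λ
  fin := tm.ΛFin
  entry := tm.main
  code l := liftStmt (tm.m l)

theorem reach_simulate (n : ℕ) (c c' : tm.Cfg) (r : Reg) (b : List Bool) (w : W → List Letter)
    (h : (flip bind tm.step)^[n] (some c) = some c') (hc' : c'.l = none) :
    (simulate tm W).Reach c.l (c.var, r) (stackFun c.stk b w) n
      (c'.var, bif c.l.isSome then r.setAns true else r) (stackFun c'.stk b w) := by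
  induction n generalizing c r with
  | zero =>
    cases h
    rw [hc']
    exact .exit _ _
  | succ n ih =>
    obtain ⟨l, hl, h⟩ := exists_step_of_iterate_succ h
    rw [hl]
    refine .step (stepAux_liftStmt ..) ?_
    have := ih _ (bif (TM2.stepAux (tm.m l) c.var c.stk).l.isSome then r else r.setAns true) h
    cases h' : (TM2.stepAux (tm.m l) c.var c.stk).l <;> simpa [h'] using this

theorem runs_simulate {l : List (tm.Γ tm.k₀)} {l' : List (tm.Γ tm.k₁)} {t : ℕ}
    (h : TM2OutputsInTime tm l (some l') t) (m : Mem tm W) (hq : m.q = tm.initialState)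
    (hs : m.s = update (fun _ => []) tm.k₀ l) :
    (simulate tm W).Runs t m { m with r := m.r.setAns true, s := update (fun _ => []) tm.k₁ l' } := by
  obtain ⟨n, hn, h⟩ : ∃ n ≤ t, (flip bind tm.step)^[n] (some (initList tm l)) =
      some (haltList tm l') := ⟨h.steps, h.steps_le_m, h.evals_in_steps⟩
  rw [initList_eq, haltList_eq] at h
  refine ⟨n, hn, ?_⟩
  rw [hq, hs]
  exact reach_simulate n _ _ m.r m.b m.w h rfl

/-- Run the simulated machine for at most as many steps as the variable `x` has letters. The flag
`ans` is set if the machine halts within this time. -/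
def simulateFor (tm : FinTM2) (x : W) : Prog tm W where
  Λ := tm.Λ
  fin := tm.ΛFin
  entry := tm.main
  code l := .pop (.inr (some x)) (fun v o => (v.1, v.2.setCur o))
    (.branch (fun v => v.2.cur.isNone) (.goto fun _ => none) (liftStmt (tm.m l)))

/-- If the simulated machine halts after `n` steps, then `simulateFor` arrives at the same result if
the clock `x` has at least `n` letters, and leaves the flag `ans` as it is otherwise. In both cases the
length of each stack is bounded in terms of the clock. -/
theorem reach_simulateFor (x : W) (n : ℕ) (c c' : tm.Cfg) (r : Reg) (b : List Bool)
    (w : W → List Letter) (h : (flip bind tm.step)^[n] (some c) = some c') (hc' : c'.l = none) :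
    ∃ k q s r' u, k ≤ (w x).length + 1 ∧ (simulateFor tm x).Reach c.l (c.var, r)
        (stackFun c.stk b w) k (q, r') (stackFun s b (update w x u)) ∧
      u.length ≤ (w x).length ∧
      (∀ k, (s k).length ≤ (c.stk k).length + maxPush tm * (w x).length) ∧
      (n ≤ (w x).length → q = c'.var ∧ s = c'.stk ∧
        r'.ans = bif c.l.isSome then true else r.ans) ∧
      ((w x).length < n → r'.ans = r.ans) := by
  induction n generalizing c r w with
  | zero =>
    cases h
    rw [hc']
    refine ⟨0, c'.var, c'.stk, r, w x, by omega, ?_, le_rfl, fun _ => Nat.le_add_right _ _,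
      fun _ => ⟨rfl, rfl, rfl⟩, fun _ => rfl⟩
    rw [update_eq_self]
    exact .exit _ _
  | succ n ih =>
    obtain ⟨l, hl, h⟩ := exists_step_of_iterate_succ h
    rw [hl]
    rcases hw : w x with _ | ⟨a, u⟩
    · refine ⟨1, c.var, c.stk, r.setCur none, [], by simp, .step ?_ (.exit _ _), le_rfl, by simp,
        by simp, by simp⟩
      simp [simulateFor, stackFun, update_stacks_some, hw]
    · obtain ⟨k, q, s, r', u', h₁, h₂, h₃, h₄, h₅, h₆⟩ :=
        ih _ (bif (TM2.stepAux (tm.m l) c.var c.stk).l.isSome then r.setCur (some a)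
          else (r.setCur (some a)).setAns true) (update w x u) h
      simp only [update_self, update_idem] at h₁ h₂ h₃ h₄ h₅ h₆
      refine ⟨k + 1, q, s, r', u', by simpa using h₁, .step ?_ h₂, by simp; omega, ?_, ?_, ?_⟩
      · simp [simulateFor, stackFun, update_stacks_some, hw, stepAux_liftStmt]
      · intro k
        refine (h₄ k).trans ?_
        have h₇ := length_stepAux_le (tm.m l) c.var c.stk k
        have h₈ := pushCount_le_maxPush tm l
        rw [List.length_cons, mul_add]
        omega
      · intro hn
        obtain ⟨h₇, h₈, h₉⟩ := h₅ (by simpa using hn)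
        refine ⟨h₇, h₈, ?_⟩
        cases h' : (TM2.stepAux (tm.m l) c.var c.stk).l <;> simpa [h'] using h₉
      · intro hn
        have hn' : u.length < n := by simpa using hn
        have h₉ := h₆ hn'
        cases h' : (TM2.stepAux (tm.m l) c.var c.stk).l with
        | some l' => simpa [h'] using h₉
        | none =>
          -- a machine that has halted cannot be run for `n > 0` further steps
          obtain ⟨n, rfl⟩ := Nat.exists_eq_succ_of_ne_zero (by omega : n ≠ 0)
          obtain ⟨l', hl', _⟩ := exists_step_of_iterate_succ h
          simp [h'] at hl'

/-- Push a letter, determined by the registers, on a stack of the simulated machine. -/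
def pushSim (k : tm.K) (f : Reg → tm.Γ k) : Prog tm W :=
  single (.push (.inl k) (fun v => f v.2) (.goto fun _ => none))

theorem runs_pushSim (k : tm.K) (f : Reg → tm.Γ k) (m : Mem tm W) :
    (pushSim k f).Runs 1 m { m with s := update m.s k (f m.r :: m.s k) } :=
  runs_single (by simp [update_stacks_inl, stackFun])

/-- Pop a letter from a stack of the simulated machine into the registers. -/
def popSim (k : tm.K) (f : Reg → Option (tm.Γ k) → Reg) : Prog tm W :=
  single (.pop (.inl k) (fun v o => (v.1, f v.2 o)) (.goto fun _ => none))

theorem runs_popSim (k : tm.K) (f : Reg → Option (tm.Γ k) → Reg) (m : Mem tm W) :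
    (popSim k f).Runs 1 m
      { m with r := f m.r (m.s k).head?, s := update m.s k (m.s k).tail } :=
  runs_single (by simp [update_stacks_inl, stackFun])

/-- Push the answer on the stack of Booleans. -/
def pushAns : Prog tm W :=
  single (.push (.inr none) (fun v => v.2.ans) (.goto fun _ => none))

theorem runs_pushAns (m : Mem tm W) :
    (pushAns : Prog tm W).Runs 1 m { m with b := m.r.ans :: m.b } :=
  runs_single (by simp [update_stacks_none, stackFun])

/-- Set the internal state of the simulated machine and the registers to their initial values. -/
def reset : Prog tm W :=
  single (.load (fun _ => (tm.initialState, Reg.init)) (.goto fun _ => none))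

theorem runs_reset (m : Mem tm W) :
    (reset : Prog tm W).Runs 1 m { m with q := tm.initialState, r := Reg.init } :=
  runs_single (by simp)

/-- Move the letters of `x` to a stack of the simulated machine, which reverses their order. -/
def feed (x : W) (k : tm.K) (f : Letter → tm.Γ k) : Prog tm W :=
  forEach x (pushSim k fun r => f r.letter)

theorem runs_feed (x : W) (k : tm.K) (f : Letter → tm.Γ k) (m : Mem tm W) :
    (feed x k f).Runs (3 * (m.w x).length + 2) m
      { m with
        r := m.r.setCur none
        s := update m.s k ((m.w x).reverse.map f ++ m.s k)
        w := update m.w x [] } := by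
  refine runs_forEach (fun _ => True) (fun m => { m with
        r := m.r.setCur none
        s := update m.s k ((m.w x).reverse.map f ++ m.s k)
        w := update m.w x [] }) 1 ?_ ?_ m trivial
  · intro m _ h
    have e : update m.w x [] = m.w := by rw [← h]; simp
    simp [h, e]
  · intro m a l _ h
    exact ⟨_, runs_pushSim .., by simp, trivial, by simp [h]⟩

/-- Empty some stacks of the simulated machine. -/
def clearSim : List tm.K → Prog tm W
  | [] => set id
  | k :: ks => ((popSim k fun r o => r.setAns o.isSome).seq
      (whileDo Reg.ans (popSim k fun r o => r.setAns o.isSome))).seq (clearSim ks)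

theorem runs_clearSim (ks : List tm.K) (M : ℕ) (m : Mem tm W) (hM : ∀ k, (m.s k).length ≤ M) :
    ∃ r, (clearSim ks).Runs (ks.length * (2 * M + 2) + 1) m
      { m with r := r, s := fun k => if k ∈ ks then [] else m.s k } := by
  have key : ∀ (k : tm.K) (l : List (tm.Γ k)) (m : Mem tm W), m.s k = l →
      ∃ r, (whileDo Reg.ans (popSim k fun r o => r.setAns o.isSome)).Runs (2 * l.length + 1)
        { m with r := m.r.setAns (m.s k).head?.isSome, s := update m.s k (m.s k).tail }
        { m with r := r, s := update m.s k [] } := by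
    intro k l
    induction l with
    | nil =>
      intro m hm
      exact ⟨m.r.setAns false, (runs_whileDo_false (by simp [hm])).congr (by simp [hm]) (by simp)⟩
    | cons a l ih =>
      intro m hm
      obtain ⟨r, h⟩ := ih { m with r := m.r.setAns true, s := update m.s k l } (by simp)
      refine ⟨r, (Runs.whileDo_true (by simp [hm]) (runs_popSim ..) (t' := 2 * l.length + 1)
        (d := { m with r := r, s := update m.s k [] }) ?_).congr rfl ?_⟩
      · simpa [hm] using h
      · simp; omega
  induction ks generalizing m with
  | nil => exact ⟨m.r, (runs_set id m).congr (by simp) (by simp)⟩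
  | cons k ks ih =>
    obtain ⟨r, h⟩ := key k _ m rfl
    obtain ⟨r', h'⟩ := ih { m with r := r, s := update m.s k [] } (by
      intro j
      by_cases hj : j = k
      · subst hj; simp
      · simpa [hj] using hM j)
    refine ⟨r', (((runs_popSim ..).seq h).seq h').congr ?_ ?_⟩
    · congr 1
      funext j
      by_cases hj : j = k
      · subst hj; simp
      · simp [hj]
    · have := hM k
      simp only [List.length_cons]
      ring_nf
      omega

end Frag

end Simulation

/-! ### Polynomial bounds -/

/-- A function on the natural numbers that is bounded by a polynomial. -/
def PolyBounded (f : ℕ → ℕ) : Prop := ∃ p : Polynomial ℕ, ∀ n, f n ≤ p.eval n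

theorem eval_mono (p : Polynomial ℕ) {a b : ℕ} (h : a ≤ b) : p.eval a ≤ p.eval b := by
  simp only [Polynomial.eval_eq_sum_range]
  gcongr

namespace PolyBounded

theorem const (c : ℕ) : PolyBounded fun _ => c := ⟨.C c, by simp⟩

theorem id : PolyBounded fun n => n := ⟨.X, by simp⟩

variable {f g : ℕ → ℕ}

theorem add (hf : PolyBounded f) (hg : PolyBounded g) : PolyBounded fun n => f n + g n := by
  obtain ⟨p, hp⟩ := hf
  obtain ⟨q, hq⟩ := hg
  exact ⟨p + q, fun n => by simpa using Nat.add_le_add (hp n) (hq n)⟩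

theorem mul (hf : PolyBounded f) (hg : PolyBounded g) : PolyBounded fun n => f n * g n := by
  obtain ⟨p, hp⟩ := hf
  obtain ⟨q, hq⟩ := hg
  exact ⟨p * q, fun n => by simpa using Nat.mul_le_mul (hp n) (hq n)⟩

theorem pow (hf : PolyBounded f) (d : ℕ) : PolyBounded fun n => f n ^ d := by
  obtain ⟨p, hp⟩ := hf
  exact ⟨p ^ d, fun n => by simpa using Nat.pow_le_pow_left (hp n) d⟩

theorem eval_comp (p : Polynomial ℕ) (hf : PolyBounded f) : PolyBounded fun n => p.eval (f n) := by
  obtain ⟨q, hq⟩ := hf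
  exact ⟨p.comp q, fun n => by simpa using eval_mono p (hq n)⟩

end PolyBounded

theorem exists_eval_le_pow (p : Polynomial ℕ) : ∃ c d : ℕ, 0 < c ∧ ∀ n, p.eval n ≤ (n + c) ^ d := by
  refine ⟨∑ i ∈ Finset.range (p.natDegree + 1), p.coeff i + 1, p.natDegree + 1, by omega,
    fun n => ?_⟩
  set c := ∑ i ∈ Finset.range (p.natDegree + 1), p.coeff i + 1 with hc
  rw [Polynomial.eval_eq_sum_range]
  calc ∑ i ∈ Finset.range (p.natDegree + 1), p.coeff i * n ^ i
      ≤ ∑ i ∈ Finset.range (p.natDegree + 1), p.coeff i * (n + c) ^ p.natDegree := by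
        refine Finset.sum_le_sum fun i hi => Nat.mul_le_mul_left _ ?_
        exact (Nat.pow_le_pow_left (by omega) i).trans
          (Nat.pow_le_pow_right (by omega) (Nat.lt_succ_iff.1 (Finset.mem_range.1 hi)))
    _ = (∑ i ∈ Finset.range (p.natDegree + 1), p.coeff i) * (n + c) ^ p.natDegree := by
        rw [Finset.sum_mul]
    _ ≤ (n + c) * (n + c) ^ p.natDegree := Nat.mul_le_mul_right _ (by omega)
    _ = (n + c) ^ (p.natDegree + 1) := by rw [pow_succ']

/-! ### The words that encode inputs and outputs -/

/-- The cells of the row of a set of attributes. -/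
def cells {m : ℕ} (S : Finset (Fin m)) : List Letter :=
  List.ofFn fun j => if j ∈ S then Letter.cross else Letter.blank

/-- The rows of a list of sets, without the marker for the end of the table. -/
def rowsWord {m : ℕ} (L : List (Finset (Fin m))) : List Letter :=
  L.flatMap fun S => cells S ++ [Letter.endRow]

theorem length_cells {m : ℕ} (S : Finset (Fin m)) : (cells S).length = m := by simp [cells]

theorem mem_cells {m : ℕ} {S : Finset (Fin m)} {a : Letter} (h : a ∈ cells S) :
    a = .cross ∨ a = .blank := by
  obtain ⟨j, hj⟩ := List.mem_ofFn.1 h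
  by_cases hS : j ∈ S <;> simp [hS] at hj <;> simp [← hj]

theorem encodeSets_eq {m : ℕ} (L : List (Finset (Fin m))) :
    encodeSets L = rowsWord L ++ [.endTable] := by
  simp [encodeSets, encodeTable, rowsWord, List.flatMap_map, encodeRow, cells]

theorem length_rowsWord {m : ℕ} (L : List (Finset (Fin m))) :
    (rowsWord L).length = L.length * (m + 1) := by
  induction L with
  | nil => simp [rowsWord]
  | cons S L ih =>
    simp only [rowsWord, List.flatMap_cons, List.length_append, length_cells, List.length_cons,
      List.length_nil] at ih ⊢
    rw [ih]
    ring

theorem length_encodeSets {m : ℕ} (L : List (Finset (Fin m))) :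
    (encodeSets L).length = L.length * (m + 1) + 1 := by
  rw [encodeSets_eq, List.length_append, length_rowsWord, List.length_singleton]

theorem endTable_notMem_rowsWord {m : ℕ} (L : List (Finset (Fin m))) :
    Letter.endTable ∉ rowsWord L := by
  simp only [rowsWord, List.mem_flatMap, List.mem_append, List.mem_singleton, not_exists, not_and]
  rintro S - (h | h)
  · simpa using mem_cells h
  · cases h

namespace ContextPair

/-- The intents of the positive examples. -/
def posRows (K : ContextPair) : List (Finset K.Attr) :=
  List.ofFn fun g => Finset.univ.filter fun j => K.posTable g j = true

/-- The intents of the negative examples. -/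
def negRows (K : ContextPair) : List (Finset K.Attr) :=
  List.ofFn fun g => Finset.univ.filter fun j => K.negTable g j = true

end ContextPair

theorem encodePair_eq (K : ContextPair) :
    encodePair K = cells (Finset.univ : Finset K.Attr) ++ .endRow :: (rowsWord K.posRows ++
      .endTable :: (rowsWord K.negRows ++ [.endTable])) := by
  have key : ∀ {n : ℕ} (T : Fin n → Fin K.attrCard → Bool),
      (List.ofFn T).flatMap encodeRow =
        rowsWord (List.ofFn fun g => Finset.univ.filter fun j => T g j = true) := by
    intro n T
    rw [rowsWord, List.ofFn_eq_map, List.ofFn_eq_map, List.flatMap_map, List.flatMap_map]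
    simp [encodeRow, cells]
  simp only [encodePair, encodeTable, ContextPair.posRows, ContextPair.negRows, key]
  simp [encodeRow, cells]

/-! ### Deciding the existence of an additional minimal hypothesis by a clocked enumeration -/

/-- The letter variables of the program for `AMH`: the input, a unary number, the unary clock, an
accumulator, scratch, and a buffer for the input of the simulated machine. -/
inductive ClockVar
  | inp
  | len
  | clk
  | acc
  | tmp
  | buf
  deriving DecidableEq

namespace ClockVar

instance : Fintype ClockVar where
  elems := {inp, len, clk, acc, tmp, buf}
  complete x := by cases x <;> simp

/-- The values of the letter variables. -/
def vals (i l c a t b : List Letter) : ClockVar → List Letter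
  | inp => i
  | len => l
  | clk => c
  | acc => a
  | tmp => t
  | buf => b

section

variable (i l c a t b u : List Letter)

@[simp] theorem vals_inp : vals i l c a t b inp = i := rfl
@[simp] theorem vals_len : vals i l c a t b len = l := rfl
@[simp] theorem vals_clk : vals i l c a t b clk = c := rfl
@[simp] theorem vals_acc : vals i l c a t b acc = a := rfl
@[simp] theorem vals_tmp : vals i l c a t b tmp = t := rfl
@[simp] theorem vals_buf : vals i l c a t b buf = b := rfl

@[simp] theorem update_inp : update (vals i l c a t b) inp u = vals u l c a t b := by
  funext x; cases x <;> rfl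
@[simp] theorem update_len : update (vals i l c a t b) len u = vals i u c a t b := by
  funext x; cases x <;> rfl
@[simp] theorem update_clk : update (vals i l c a t b) clk u = vals i l u a t b := by
  funext x; cases x <;> rfl
@[simp] theorem update_acc : update (vals i l c a t b) acc u = vals i l c u t b := by
  funext x; cases x <;> rfl
@[simp] theorem update_tmp : update (vals i l c a t b) tmp u = vals i l c a u b := by
  funext x; cases x <;> rfl
@[simp] theorem update_buf : update (vals i l c a t b) buf u = vals i l c a t u := by
  funext x; cases x <;> rfl

end

end ClockVar

namespace Frag

open ClockVar

variable {tm : FinTM2}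

/-- Multiply the unary number `clk` by the unary number `len`. -/
def mulClock : Prog tm ClockVar :=
  (forEach clk (prepend len acc tmp)).seq (move acc clk)

theorem runs_mulClock (q : tm.σ) (s : ∀ k, List (tm.Γ k)) (bs : List Bool) (r : Reg)
    (i l c b : List Letter) :
    ∃ c', c'.length = c.length * l.length ∧
      (mulClock : Prog tm ClockVar).Runs
        (c.length * (7 * l.length + 6) + 3 * (c.length * l.length) + 4)
        ⟨q, s, bs, r, vals i l c [] [] b⟩ ⟨q, s, bs, r.setCur none, vals i l c' [] [] b⟩ := by
  have h := runs_forEach (tm := tm) (x := clk) (F := prepend len acc tmp)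
    (fun m => ∃ q s bs r c a, m = ⟨q, s, bs, r, vals i l c a [] b⟩)
    (fun m => { m with
      r := m.r.setCur none
      w := update (update m.w clk []) acc
        ((List.replicate (m.w clk).length l).flatten ++ m.w acc) }) (7 * l.length + 4)
    (by
      rintro _ ⟨q, s, bs, r, c, a, rfl⟩ hc
      obtain rfl : c = [] := hc
      simp)
    (by
      rintro _ y u ⟨q, s, bs, r, c, a, rfl⟩ hc
      obtain rfl : c = y :: u := hc
      refine ⟨_, (runs_prepend (by decide) (by decide) (by decide) _ (by simp)).congr rfl (by simp),
        by simp, ⟨_, _, _, _, _, _, by simp; exact ⟨rfl, rfl, rfl, rfl, rfl⟩⟩, ?_⟩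
      simp [List.replicate_succ'])
    ⟨q, s, bs, r, vals i l c [] [] b⟩ ⟨_, _, _, _, _, _, rfl⟩
  refine ⟨((List.replicate c.length l).flatten).reverse, by simp,
    (h.seq (runs_move (by decide) _)).congr ?_ ?_⟩
  · simp
  · simp
    ring_nf
    omega

/-- Compute the `d`-th power of the unary number `len`, if `clk` is one. -/
def powClock : ℕ → Prog tm ClockVar
  | 0 => set fun r => r.setCur none
  | d + 1 => (powClock d).seq mulClock

theorem runs_powClock (d : ℕ) (q : tm.σ) (s : ∀ k, List (tm.Γ k)) (bs : List Bool) (r : Reg)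
    (i l b : List Letter) (hl : 0 < l.length) (x : Letter) :
    ∃ c, c.length = l.length ^ d ∧
      (powClock d : Prog tm ClockVar).Runs (d * (16 * l.length ^ d + 4) + 1)
        ⟨q, s, bs, r, vals i l [x] [] [] b⟩ ⟨q, s, bs, r.setCur none, vals i l c [] [] b⟩ := by
  induction d with
  | zero => exact ⟨[x], by simp, (runs_set ..).congr rfl (by simp)⟩
  | succ d ih =>
    obtain ⟨c, hc, h⟩ := ih
    obtain ⟨c', hc', h'⟩ := runs_mulClock q s bs (r.setCur none) i l c b
    refine ⟨c', by rw [hc', hc, pow_succ], (h.seq h').congr (by simp) ?_⟩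
    rw [hc]
    have h₁ : l.length ^ d ≤ l.length ^ (d + 1) := Nat.pow_le_pow_right hl (by omega)
    have h₂ : l.length ^ d * (7 * l.length + 6) = 7 * l.length ^ (d + 1) + 6 * l.length ^ d := by
      ring
    have h₃ : l.length ^ d * l.length = l.length ^ (d + 1) := by ring
    have h₄ : d * (16 * l.length ^ d + 4) ≤ d * (16 * l.length ^ (d + 1) + 4) :=
      Nat.mul_le_mul_left _ (by omega)
    have h₅ : (d + 1) * (16 * l.length ^ (d + 1) + 4) =
      d * (16 * l.length ^ (d + 1) + 4) + 16 * l.length ^ (d + 1) + 4 := by ring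
    omega

/-- Increase the unary number `len` by `c`. -/
def addLen : ℕ → Prog tm ClockVar
  | 0 => set id
  | c + 1 => (push len fun _ => .cross).seq (addLen c)

theorem runs_addLen (n : ℕ) (q : tm.σ) (s : ∀ k, List (tm.Γ k)) (bs : List Bool) (r : Reg)
    (i l c a t b : List Letter) :
    ∃ l', l'.length = l.length + n ∧
      (addLen n : Prog tm ClockVar).Runs (n + 1)
        ⟨q, s, bs, r, vals i l c a t b⟩ ⟨q, s, bs, r, vals i l' c a t b⟩ := by
  induction n generalizing l with
  | zero => exact ⟨l, rfl, runs_set id _⟩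
  | succ n ih =>
    obtain ⟨l', hl', h⟩ := ih (.cross :: l)
    refine ⟨l', by rw [hl', List.length_cons]; omega,
      ((runs_push len (fun _ => .cross) ⟨q, s, bs, r, vals i l c a t b⟩).seq ?_).congr rfl
        (by omega : 1 + (n + 1) ≤ n + 1 + 1)⟩
    simpa using h

/-- Compare the number of letters of `inp` with that on a stack of the simulated machine: the flag
`ans` is set if the latter is larger. -/
def compareLength (k : tm.K) : Prog tm ClockVar :=
  (forEach inp (popSim k fun r _ => r)).seq (popSim k fun r o => r.setAns o.isSome)

theorem runs_compareLength (k : tm.K) (m : Mem tm ClockVar) :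
    (compareLength k).Runs (3 * (m.w inp).length + 3) m
      { m with
        r := (m.r.setCur none).setAns (decide ((m.w inp).length < (m.s k).length))
        s := update m.s k ((m.s k).drop ((m.w inp).length + 1))
        w := update m.w inp [] } := by
  have h := runs_forEach (tm := tm) (x := inp) (F := popSim k fun r _ => r) (fun _ => True)
    (fun m => { m with
      r := m.r.setCur none
      s := update m.s k ((m.s k).drop (m.w inp).length)
      w := update m.w inp [] }) 1
    (by
      intro m _ h
      have e : update m.w inp [] = m.w := by rw [← h]; simp
      simp [h, e])
    (by
      intro m a l _ h
      refine ⟨_, runs_popSim .., by simp, trivial, ?_⟩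
      simp [h])
    m trivial
  refine (h.seq (runs_popSim ..)).congr ?_ (by omega)
  have : ((m.s k)[(m.w inp).length]?).isSome = decide ((m.w inp).length < (m.s k).length) := by
    by_cases h : (m.w inp).length < (m.s k).length
    · simp [h]
    · simp [h]
  simp [this]

/-- The program for `AMH`. Its clock is the `d`-th power of the length of the input plus `c`. -/
noncomputable def amhProg (c d : ℕ) (f : Letter → tm.Γ tm.k₀) : Prog tm ClockVar :=
  haveI := tm.kFin
  -- set up the clock
  (prepend inp len tmp).seq <| (addLen c).seq <| (push clk fun _ => .cross).seq <|
  (powClock d).seq <|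
  -- hand the pair of contexts to the simulated machine
  (takeUntil .endTable inp buf).seq <| (push buf fun _ => .endTable).seq <|
  (takeUntil .endTable inp buf).seq <| (push buf fun _ => .endTable).seq <|
  (feed buf tm.k₀ f).seq <|
  (simulateFor tm clk).seq <|
  (ite Reg.ans (compareLength tm.k₁) (set fun r => r.setAns true)).seq <|
  pushAns.seq <|
  -- clean up
  (clear inp).seq <| (clear len).seq <| (clear clk).seq <|
  (clearSim (Finset.univ : Finset tm.K).toList).seq reset

/-- The time that the program for `AMH` needs, in terms of the length of its input. -/
noncomputable def amhTime (tm : FinTM2) (c d n : ℕ) : ℕ :=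
  haveI := tm.kFin
  d * (16 * (n + c) ^ d + 4) + 4 * (n + c) ^ d + 40 * (n + c) +
    Fintype.card tm.K * (2 * (n + maxPush tm * (n + c) ^ d) + 2) + 40

theorem polyBounded_amhTime (tm : FinTM2) (c d : ℕ) : PolyBounded (amhTime tm c d) := by
  have h : PolyBounded fun n => (n + c) ^ d := (PolyBounded.id.add (.const c)).pow d
  exact (((((PolyBounded.const d).mul (((PolyBounded.const 16).mul h).add (.const 4))).add
    ((PolyBounded.const 4).mul h)).add ((PolyBounded.const 40).mul (PolyBounded.id.add (.const c)))).add
    ((PolyBounded.const _).mul (((PolyBounded.const 2).mul (PolyBounded.id.add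
      ((PolyBounded.const _).mul h))).add (.const 2)))).add (.const 40)

/-- The program for `AMH` finds out whether the output `out` of the simulated machine on the pair of
contexts is longer than the list `w` of known hypotheses, if the clock suffices for all outputs that
are not. -/
theorem runs_amhProg {c d t : ℕ} (hc : 0 < c) {f : Letter → tm.Γ tm.k₀} {u v w : List Letter}
    {out : List (tm.Γ tm.k₁)} (hu : Letter.endTable ∉ u) (hv : Letter.endTable ∉ v)
    (h : TM2OutputsInTime tm ((u ++ Letter.endTable :: (v ++ [.endTable])).map f) (some out) t)
    (ht : out.length ≤ w.length →
      t ≤ ((u ++ Letter.endTable :: (v ++ .endTable :: w)).length + c) ^ d) :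
    (amhProg c d f).Runs (amhTime tm c d (u ++ Letter.endTable :: (v ++ .endTable :: w)).length)
      ⟨tm.initialState, fun _ => [], [], Reg.init,
        vals (u ++ Letter.endTable :: (v ++ .endTable :: w)) [] [] [] [] []⟩
      ⟨tm.initialState, fun _ => [], [decide (w.length < out.length)], Reg.init,
        vals [] [] [] [] [] []⟩ := by
  let _ := tm.kFin
  set x := u ++ .endTable :: (v ++ .endTable :: w) with hx
  have hxl : x.length = u.length + v.length + w.length + 2 := by
    simp [hx]; omega
  have r₁ := runs_prepend (tm := tm) (x := inp) (y := len) (z := tmp) (by decide) (by decide)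
    (by decide) ⟨tm.initialState, fun _ => [], [], Reg.init, vals x [] [] [] [] []⟩ (by simp)
  simp only [vals_inp, vals_len, update_len, List.append_nil] at r₁
  obtain ⟨l, hl, r₂⟩ := runs_addLen c tm.initialState (fun _ => []) [] (Reg.init.setCur none)
    x x [] [] [] []
  have r₃ := runs_push (tm := tm) clk (fun _ => Letter.cross)
    ⟨tm.initialState, fun _ => [], [], Reg.init.setCur none, vals x l [] [] [] []⟩
  simp only [vals_clk, update_clk] at r₃
  obtain ⟨k, hk, r₄⟩ := runs_powClock d tm.initialState (fun _ => []) [] (Reg.init.setCur none)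
    x l [] (by omega) .cross
  simp only [Reg.setCur_setCur] at r₄
  have r₅ := runs_takeUntil (tm := tm) (c := .endTable) (x := inp) (y := buf) (by decide)
    ⟨tm.initialState, fun _ => [], [], Reg.init.setCur none, vals x l k [] [] []⟩ u _ hx hu
  have r₆ := runs_push (tm := tm) buf (fun _ => .endTable)
    ⟨tm.initialState, fun _ => [], [], Reg.init.setCur none,
      vals (v ++ .endTable :: w) l k [] [] u.reverse⟩
  have r₇ := runs_takeUntil (tm := tm) (c := .endTable) (x := inp) (y := buf) (by decide)
    ⟨tm.initialState, fun _ => [], [], Reg.init.setCur none,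
      vals (v ++ .endTable :: w) l k [] [] (.endTable :: u.reverse)⟩ v _ rfl hv
  have r₈ := runs_push (tm := tm) buf (fun _ => .endTable)
    ⟨tm.initialState, fun _ => [], [], Reg.init.setCur none,
      vals w l k [] [] (v.reverse ++ .endTable :: u.reverse)⟩
  have r₉ := runs_feed (tm := tm) buf tm.k₀ f
    ⟨tm.initialState, fun _ => [], [], Reg.init.setCur none,
      vals w l k [] [] (.endTable :: (v.reverse ++ .endTable :: u.reverse))⟩
  simp only [vals_buf, update_inp, update_buf, List.append_nil, Reg.setCur_setCur]
    at r₅ r₆ r₇ r₈ r₉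
  obtain ⟨n, hn, h⟩ : ∃ n ≤ t, (flip bind tm.step)^[n]
      (some (initList tm ((u ++ Letter.endTable :: (v ++ [.endTable])).map f))) =
      some (haltList tm out) := ⟨h.steps, h.steps_le_m, h.evals_in_steps⟩
  rw [initList_eq, haltList_eq] at h
  obtain ⟨j, q, s, r, k', hj, r₁₀, hk', hs, hfin, hout⟩ := reach_simulateFor clk n _ _
    (Reg.init.setCur none) [] (vals w l k [] [] []) h rfl
  simp only [vals_clk, update_clk] at hj r₁₀ hk' hs hfin hout
  have hkl : k.length = (x.length + c) ^ d := by rw [hk, hl]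
  have hM : ∀ i, (s i).length ≤ x.length + maxPush tm * (x.length + c) ^ d := by
    intro i
    refine (hs i).trans ?_
    rw [hkl]
    refine Nat.add_le_add_right ?_ _
    by_cases hi : i = tm.k₀
    · subst hi; simp [hxl]; omega
    · simp [hi]
  obtain ⟨s', w', r', r₁₁, hr', hs', hw'⟩ : ∃ s' w' r',
      (ite Reg.ans (compareLength tm.k₁) (set fun r => r.setAns true)).Runs (3 * w.length + 4)
        ⟨q, s, [], r, vals w l k' [] [] []⟩ ⟨q, s', [], r', vals w' l k' [] [] []⟩ ∧
      r'.ans = decide (w.length < out.length) ∧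
      (∀ i, (s' i).length ≤ x.length + maxPush tm * (x.length + c) ^ d) ∧
      w'.length ≤ w.length := by
    rcases le_or_gt n k.length with hnk | hnk
    · obtain ⟨-, rfl, hr⟩ := hfin hnk
      refine ⟨_, [], _, Runs.ite_true (by simpa using hr)
        ((runs_compareLength ..).congr (by simp; exact ⟨rfl, rfl⟩) le_rfl), by simp, ?_, by simp⟩
      intro i
      refine le_trans ?_ (hM i)
      by_cases hi : i = tm.k₁
      · subst hi; simp
      · simp [hi]
    · refine ⟨s, w, _, Runs.ite_false (by rw [hout hnk]; rfl)
        ((runs_set ..).congr rfl (by omega)), ?_, hM, le_rfl⟩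
      -- the clock can only run out if there is more output than for the known hypotheses
      have : w.length < out.length := by
        by_contra hlt
        have := ht (by omega)
        omega
      simp [this]
  have r₁₂ := runs_pushAns ⟨q, s', [], r', vals w' l k' [] [] []⟩
  have r₁₃ := runs_clear inp ⟨q, s', [r'.ans], r', vals w' l k' [] [] []⟩
  have r₁₄ := runs_clear len ⟨q, s', [r'.ans], r'.setCur none, vals [] l k' [] [] []⟩
  have r₁₅ := runs_clear clk ⟨q, s', [r'.ans], r'.setCur none, vals [] [] k' [] [] []⟩
  obtain ⟨r'', r₁₆⟩ := runs_clearSim (Finset.univ : Finset tm.K).toList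
    (x.length + maxPush tm * (x.length + c) ^ d)
    ⟨q, s', [r'.ans], r'.setCur none, vals [] [] [] [] [] []⟩ hs'
  simp only [vals_inp, vals_len, vals_clk, update_inp, update_len, update_clk, Reg.setCur_setCur,
    Finset.mem_toList, Finset.mem_univ, if_true, Finset.length_toList, Finset.card_univ]
    at r₁₃ r₁₄ r₁₅ r₁₆
  have r₁₀' : (simulateFor tm clk).Runs (k.length + 1)
      ⟨tm.initialState, update (fun _ => []) tm.k₀
        ((u ++ Letter.endTable :: (v ++ [.endTable])).map f), [], Reg.init.setCur none,
        vals w l k [] [] []⟩ ⟨q, s, [], r, vals w l k' [] [] []⟩ := ⟨j, hj, r₁₀⟩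
  refine (r₁.seq <| r₂.seq <| r₃.seq <| r₄.seq <| r₅.seq <| r₆.seq <| r₇.seq <| r₈.seq <|
    (r₉.congr (by simp) le_rfl).seq <| r₁₀'.seq <| r₁₁.seq <| r₁₂.seq <| r₁₃.seq <| r₁₄.seq <|
    r₁₅.seq <| r₁₆.seq <| runs_reset _).congr ?_ ?_
  · rw [hr']
  · simp only [amhTime, hkl, hl, hxl, List.length_append, List.length_cons, List.length_reverse]
    simp only [hkl] at hk'
    rw [hxl] at hk'
    omega

end Frag

/-- A machine that enumerates the minimal hypotheses in output-polynomial time yields one for `AMH`: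
its output on the given contexts is longer than the list of known hypotheses if and only if there is
an additional one, and it is within its time bound for the shorter list if there is none. -/
theorem inP_AMH_of_solvable_MHE (h : SolvableInOutputPolyTime encodePair MHE) :
    InP encodeAMH AMH := by
  obtain ⟨M, p, hM⟩ := h
  obtain ⟨c, d, hc, hp⟩ := exists_eval_le_pow p
  obtain ⟨T, hT⟩ := (Frag.polyBounded_amhTime M.tm c d).add (.const 1)
  let _ := M.tm.kFin
  let _ := M.tm.σFin
  refine ⟨⟨⟨(Frag.amhProg c d M.inputAlphabet.symm).toFinTM2 (.inr (some .inp)) (.inr none)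
    (M.tm.initialState, Reg.init), Equiv.refl _, Equiv.refl _⟩, T, fun x => ?_⟩⟩
  refine Nonempty.some ?_
  obtain ⟨w, ⟨L, hL, hmem, rfl⟩, ⟨hrun⟩⟩ := hM x.toContextPair
  have hlen : (encodeSets L).length ≤ (encodeSets x.known).length ↔ L.length ≤ x.known.length := by
    simp [length_encodeSets]
  have hsub : x.known ⊆ L := fun H hH => (hmem H).2 (x.known_minimal H hH)
  have hans : AMH x ↔ (encodeSets x.known).length < (encodeSets L).length := by
    rw [← not_le, hlen, not_le]
    constructor
    · rintro ⟨H, hH, hH'⟩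
      have := (List.nodup_cons.2 ⟨hH', x.known_nodup⟩).subperm (l₂ := L)
        (List.cons_subset.2 ⟨(hmem H).2 hH, hsub⟩)
      exact this.length_le
    · intro hlt
      by_contra hno
      have := hL.subperm (l₂ := x.known) fun H hH => by
        by_contra hH'
        exact hno ⟨H, (hmem H).1 hH, hH'⟩
      exact absurd this.length_le (by omega)
  set u := cells (Finset.univ : Finset x.Attr) ++ .endRow :: rowsWord x.posRows
  set v := rowsWord x.negRows
  have hpair : encodePair x.toContextPair = u ++ .endTable :: (v ++ [.endTable]) := by
    rw [encodePair_eq]; simp [u, v]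
  have henc : encodeAMH x = u ++ .endTable :: (v ++ .endTable :: encodeSets x.known) := by
    rw [encodeAMH, hpair]; simp
  have hu : Letter.endTable ∉ u := by
    intro h
    rcases List.mem_append.1 h with h | h
    · simpa using mem_cells h
    · rcases List.mem_cons.1 h with h | h
      · cases h
      · exact endTable_notMem_rowsWord _ h
  have hv : Letter.endTable ∉ v := endTable_notMem_rowsWord _
  rw [hpair] at hrun
  obtain ⟨n, hn, hr⟩ := Frag.runs_amhProg (d := d) hc hu hv hrun (w := encodeSets x.known) (by
    intro hle
    rw [List.length_map] at hle
    refine (hp _).trans (Nat.pow_le_pow_left (Nat.add_le_add_right ?_ c) d)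
    simp only [List.length_append, List.length_cons, List.length_nil]
    omega)
  rw [← henc] at hn hr
  have h₀ : ∀ y, ClockVar.vals y [] [] [] [] [] = update (fun _ => []) ClockVar.inp y := by
    intro y
    funext k
    cases k <;> rfl
  have h₁ : ClockVar.vals [] [] [] [] [] [] = fun _ => [] := by
    funext k
    cases k <;> rfl
  simp only [h₁, stackFun_single_none] at hr
  simp only [h₀, stackFun_single_some] at hr
  have := hr.outputs (m := T.eval (encodeAMH x).length)
    ((Nat.add_le_add_right hn 1).trans (hT _))
  have e : @decide (AMH x) (Classical.propDecidable _) = decide ((encodeSets x.known).length <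
      ((encodeSets L).map M.outputAlphabet.invFun).length) := by
    rw [List.length_map]
    exact decide_eq_decide.2 hans
  rw [e]
  exact this

/-! ### Hypotheses in terms of rows -/

section Rows

variable {m : ℕ}

/-- `H` is an intent of the context whose object intents are the sets in `P`: it is the intersection
of those sets in `P` that contain it. -/
def RowIntent (P : List (Finset (Fin m))) (H : Finset (Fin m)) : Prop :=
  ∀ j, (∀ R ∈ P, H ⊆ R → j ∈ R) → j ∈ H

/-- Hypotheses, for lists of positive and negative object intents. -/
def RowHyp (P N : List (Finset (Fin m))) (H : Finset (Fin m)) : Prop :=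
  RowIntent P H ∧ ∀ R ∈ N, ¬ H ⊆ R

/-- Minimal hypotheses, for lists of positive and negative object intents, with the convention that
the full set is the only one if there are no hypotheses. -/
def RowMinHyp (P N : List (Finset (Fin m))) (H : Finset (Fin m)) : Prop :=
  ((∃ F, RowHyp P N F) ∧ Minimal (RowHyp P N) H) ∨ ((¬ ∃ F, RowHyp P N F) ∧ H = Finset.univ)

theorem ContextPair.isHypothesis_iff (K : ContextPair) (H : Finset K.Attr) :
    K.IsHypothesis H ↔ RowHyp K.posRows K.negRows H := by
  unfold IsHypothesis RowHyp
  refine and_congr ?_ ?_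
  · rw [Order.isIntent_iff]
    constructor
    · intro h j hj
      have : j ∈ upperPolar K.posRel (lowerPolar K.posRel (H : Set K.Attr)) := by
        intro g hg
        have := hj (Finset.univ.filter fun j => K.posTable g j = true)
          (List.mem_ofFn.2 ⟨g, rfl⟩) (fun i hi => by simpa [posRel] using hg (Finset.mem_coe.2 hi))
        simpa [posRel] using this
      rw [h] at this
      exact this
    · intro h
      refine Set.Subset.antisymm (fun j hj => h j ?_) (subset_upperPolar_lowerPolar _ _)
      intro R hR hHR
      obtain ⟨g, rfl⟩ := List.mem_ofFn.1 hR
      have : K.posRel g j := hj fun i hi => by simpa [posRel] using hHR hi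
      simpa [posRel] using this
  · constructor
    · intro h R hR hHR
      obtain ⟨g, rfl⟩ := List.mem_ofFn.1 hR
      exact h g fun i hi => by simpa [ContextPair.negRel] using hHR hi
    · intro h g hg
      refine h _ (List.mem_ofFn.2 ⟨g, rfl⟩) fun i hi => ?_
      simpa [ContextPair.negRel] using hg (Finset.mem_coe.2 hi)

theorem ContextPair.isMinimalHypothesis_iff (K : ContextPair) (H : Finset K.Attr) :
    K.IsMinimalHypothesis H ↔ RowMinHyp K.posRows K.negRows H := by
  have : K.IsHypothesis = RowHyp K.posRows K.negRows := funext fun F => propext (K.isHypothesis_iff F)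
  unfold IsMinimalHypothesis RowMinHyp
  rw [this]

/-- The pair of contexts with given object intents. -/
def ofRows (P N : List (Finset (Fin m))) : ContextPair where
  posCard := P.length
  negCard := N.length
  attrCard := m
  posTable g j := decide (j ∈ P[g])
  negTable g j := decide (j ∈ N[g])

theorem posRows_ofRows (P N : List (Finset (Fin m))) : (ofRows P N).posRows = P := by
  have h (S : Finset (Fin m)) : (Finset.univ.filter fun j => decide (j ∈ S) = true) = S := by
    ext; simp
  exact (congrArg List.ofFn (funext fun g : Fin P.length => h P[g])).trans (List.ofFn_getElem (xs := P))

theorem negRows_ofRows (P N : List (Finset (Fin m))) : (ofRows P N).negRows = N := by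
  have h (S : Finset (Fin m)) : (Finset.univ.filter fun j => decide (j ∈ S) = true) = S := by
    ext; simp
  exact (congrArg List.ofFn (funext fun g : Fin N.length => h N[g])).trans (List.ofFn_getElem (xs := N))

variable {P P' N known : List (Finset (Fin m))} {H T S : Finset (Fin m)}

theorem rowIntent_univ : RowIntent P Finset.univ := fun _ _ => Finset.mem_univ _

theorem rowIntent_of_mem (h : H ∈ P) : RowIntent P H := fun _ hj => hj H h subset_rfl

theorem RowIntent.inter (hS : RowIntent P S) (hT : RowIntent P T) : RowIntent P (S ∩ T) := by
  intro j hj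
  rw [Finset.mem_inter]
  exact ⟨hS j fun R hR h => hj R hR (Finset.inter_subset_left.trans h),
    hT j fun R hR h => hj R hR (Finset.inter_subset_right.trans h)⟩

theorem RowIntent.trans (h : RowIntent P' H) (hP : ∀ R ∈ P', RowIntent P R) : RowIntent P H :=
  fun j hj => h j fun R' hR' h' => hP R' hR' j fun R hR hh => hj R hR (h'.trans hh)

theorem RowIntent.eq_univ_or (h : RowIntent P H) : H = Finset.univ ∨ ∃ R ∈ P, H ⊆ R := by
  by_cases hR : ∃ R ∈ P, H ⊆ R
  · exact .inr hR
  · push Not at hR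
    exact .inl (Finset.eq_univ_of_forall fun j => h j fun R h₁ h₂ => absurd h₂ (hR R h₁))

theorem RowMinHyp.rowIntent (h : RowMinHyp P N H) : RowIntent P H := by
  rcases h with ⟨-, h⟩ | ⟨-, rfl⟩
  · exact h.prop.1
  · exact rowIntent_univ

/-- The positive object intents of the auxiliary contexts by which a further minimal hypothesis
contained in `T` is searched: the parts of the given ones in `T`, the set `T` itself, and the known
minimal hypotheses. -/
def auxRows (P known : List (Finset (Fin m))) (T : Finset (Fin m)) : List (Finset (Fin m)) :=
  T :: (P.map (· ∩ T) ++ known)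

/-- The minimal hypotheses of the auxiliary contexts are the known ones and those contained in `T`.
Indeed, a minimal hypothesis of the auxiliary contexts is contained in one of their positive rows, or
it is the full set and so contains the hypothesis `T`. If it is contained in a known minimal
hypothesis, then it is equal to this one, because it is also a hypothesis of the given contexts. -/
theorem rowMinHyp_auxRows_iff (hT : RowIntent P T) (hTN : T = Finset.univ ∨ ∀ R ∈ N, ¬ T ⊆ R)
    (hk : ∀ H ∈ known, RowMinHyp P N H) :
    RowMinHyp (auxRows P known T) N H ↔ RowMinHyp P N H ∧ (H ⊆ T ∨ H ∈ known) := by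
  have hrows : ∀ R ∈ auxRows P known T, RowIntent P R := by
    intro R hR
    simp only [auxRows, List.mem_cons, List.mem_append, List.mem_map] at hR
    rcases hR with rfl | ⟨R, hR, rfl⟩ | hR
    · exact hT
    · exact (rowIntent_of_mem hR).inter hT
    · exact (hk R hR).rowIntent
  have hsub : ∀ F, RowHyp (auxRows P known T) N F → RowHyp P N F :=
    fun F hF => ⟨hF.1.trans hrows, hF.2⟩
  have hsup : ∀ F, RowHyp P N F → F ⊆ T → RowHyp (auxRows P known T) N F := by
    refine fun F hF hFT => ⟨fun j hj => hF.1 j fun R hR hFR => ?_, hF.2⟩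
    have := hj (R ∩ T) (by simp only [auxRows, List.mem_cons, List.mem_append, List.mem_map]
                           exact .inr (.inl ⟨R, hR, rfl⟩)) (Finset.subset_inter hFR hFT)
    exact (Finset.mem_inter.1 this).1
  by_cases hex : ∃ F, RowHyp P N F
  · have hTN' : ∀ R ∈ N, ¬ T ⊆ R := by
      rcases hTN with rfl | h
      · obtain ⟨F, hF⟩ := hex
        exact fun R hR h => hF.2 R hR ((Finset.subset_univ F).trans h)
      · exact h
    have hT' : RowHyp (auxRows P known T) N T := hsup T ⟨hT, hTN'⟩ subset_rfl
    have hmin : ∀ F, RowMinHyp P N F ↔ Minimal (RowHyp P N) F := by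
      intro F; simp only [RowMinHyp, hex, true_and, not_true_eq_false, false_and, or_false]
    have hmin' : RowMinHyp (auxRows P known T) N H ↔ Minimal (RowHyp (auxRows P known T) N) H := by
      have : ∃ F, RowHyp (auxRows P known T) N F := ⟨T, hT'⟩
      simp only [RowMinHyp, this, true_and, not_true_eq_false, false_and, or_false]
    rw [hmin, hmin']
    constructor
    · intro h
      have hH : H ⊆ T ∨ H ∈ known := by
        rcases h.prop.1.eq_univ_or with rfl | ⟨R, hR, hHR⟩
        · exact .inl (h.le_of_le hT' (Finset.subset_univ T))
        · simp only [auxRows, List.mem_cons, List.mem_append, List.mem_map] at hR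
          rcases hR with rfl | ⟨R, hR, rfl⟩ | hR
          · exact .inl hHR
          · exact .inl (hHR.trans Finset.inter_subset_right)
          · right
            have := ((hmin R).1 (hk R hR)).eq_of_le (hsub H h.prop) hHR
            rwa [← this] at hR
      refine ⟨⟨hsub H h.prop, fun F hF hFH => ?_⟩, hH⟩
      rcases hH with hH | hH
      · exact h.le_of_le (hsup F hF (le_trans hFH hH)) hFH
      · exact ((hmin H).1 (hk H hH)).le_of_le hF hFH
    · rintro ⟨h, hH⟩
      refine ⟨?_, fun F hF hFH => h.le_of_le (hsub F hF) hFH⟩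
      rcases hH with hH | hH
      · exact hsup H h.prop hH
      · exact ⟨rowIntent_of_mem (by
          simp only [auxRows, List.mem_cons, List.mem_append]
          exact .inr (.inr hH)), h.prop.2⟩
  · have hT' : T = Finset.univ := by
      rcases hTN with h | h
      · exact h
      · exact absurd ⟨T, hT, h⟩ hex
    have hex' : ¬ ∃ F, RowHyp (auxRows P known T) N F := fun ⟨F, hF⟩ => hex ⟨F, hsub F hF⟩
    simp only [RowMinHyp, hex, hex', false_and, false_or, not_false_eq_true, true_and]
    simp [hT']

/-- There is a further minimal hypothesis contained in `T`. -/
def HasNew (P N known : List (Finset (Fin m))) (T : Finset (Fin m)) : Prop :=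
  ∃ H, RowMinHyp P N H ∧ H ∉ known ∧ H ⊆ T

/-- If some negative example has all the attributes in `T`, then only the full set can be a minimal
hypothesis contained in `T`. -/
theorem HasNew.eq_univ (h : HasNew P N known T) {R : Finset (Fin m)} (hR : R ∈ N) (hTR : T ⊆ R) :
    T = Finset.univ := by
  obtain ⟨H, h₁, -, h₃⟩ := h
  rcases h₁ with ⟨-, h⟩ | ⟨-, rfl⟩
  · exact absurd (h₃.trans hTR) (h.prop.2 R hR)
  · exact Finset.univ_subset_iff.1 h₃

/-- The instance of `AMH` that asks for a further minimal hypothesis contained in `T`. -/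
theorem exists_amhInstance (hT : RowIntent P T) (hTN : T = Finset.univ ∨ ∀ R ∈ N, ¬ T ⊆ R)
    (hk : ∀ H ∈ known, RowMinHyp P N H) (hkn : known.Nodup) :
    ∃ x : AMHInstance, (AMH x ↔ HasNew P N known T) ∧
      encodeAMH x = cells (Finset.univ : Finset (Fin m)) ++ .endRow ::
        (rowsWord (auxRows P known T) ++ .endTable :: (rowsWord N ++ .endTable ::
          (rowsWord known ++ [.endTable]))) := by
  have hmin : ∀ H, (ofRows (auxRows P known T) N).IsMinimalHypothesis H ↔
      RowMinHyp P N H ∧ (H ⊆ T ∨ H ∈ known) := by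
    intro H
    rw [ContextPair.isMinimalHypothesis_iff, posRows_ofRows, negRows_ofRows]
    exact rowMinHyp_auxRows_iff hT hTN hk
  refine ⟨⟨ofRows (auxRows P known T) N, known, hkn, fun H hH => (hmin H).2 ⟨hk H hH, .inr hH⟩⟩,
    ?_, ?_⟩
  · constructor
    · rintro ⟨H, h₁, h₂⟩
      obtain ⟨h₃, h₄⟩ := (hmin H).1 h₁
      exact ⟨H, h₃, h₂, h₄.resolve_right h₂⟩
    · rintro ⟨H, h₁, h₂, h₃⟩
      exact ⟨H, (hmin H).2 ⟨h₁, .inl h₃⟩, h₂⟩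
  · rw [encodeAMH, encodePair_eq, encodeSets_eq, posRows_ofRows, negRows_ofRows]
    simp only [List.append_assoc, List.cons_append, List.nil_append]
    rfl

open Classical in
/-- One step of the search for a further minimal hypothesis: keep the attributes in `R` only, if some
further minimal hypothesis remains. -/
noncomputable def shrink (P N known : List (Finset (Fin m))) (S R : Finset (Fin m)) :
    Finset (Fin m) :=
  if HasNew P N known (S ∩ R) then S ∩ R else S

theorem RowIntent.shrink (hS : RowIntent P S) {R : Finset (Fin m)} (hR : R ∈ P) :
    RowIntent P (shrink P N known S R) := by
  unfold HypothesisEnumeration.shrink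
  split_ifs
  · exact hS.inter (rowIntent_of_mem hR)
  · exact hS

theorem shrink_subset (S R : Finset (Fin m)) : shrink P N known S R ⊆ S := by
  unfold shrink
  split_ifs
  · exact Finset.inter_subset_left
  · exact subset_rfl

theorem foldl_shrink (l : List (Finset (Fin m))) (h : HasNew P N known S) :
    HasNew P N known (l.foldl (shrink P N known) S) ∧ l.foldl (shrink P N known) S ⊆ S ∧
      ∀ H, RowMinHyp P N H → H ∉ known → H ⊆ l.foldl (shrink P N known) S →
        ∀ R ∈ l, H ⊆ R → l.foldl (shrink P N known) S ⊆ R := by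
  induction l generalizing S with
  | nil => simpa using h
  | cons R l ih =>
    have h' : HasNew P N known (shrink P N known S R) := by
      unfold shrink
      split_ifs with hn
      exacts [hn, h]
    obtain ⟨h₁, h₂, h₃⟩ := ih h'
    refine ⟨h₁, h₂.trans (shrink_subset S R), fun H hH hHk hHS R' hR' hHR' => ?_⟩
    rcases List.mem_cons.1 hR' with rfl | hR'
    · have hn : HasNew P N known (S ∩ R') := ⟨H, hH, hHk,
        Finset.subset_inter (hHS.trans (h₂.trans (shrink_subset S R'))) hHR'⟩
      have e : shrink P N known S R' = S ∩ R' := by simp [shrink, hn]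
      exact h₂.trans (e ▸ Finset.inter_subset_right)
    · exact h₃ H hH hHk hHS R' hR' hHR'

/-- The search finds a further minimal hypothesis, if there is one. The result `S` contains one, `H`
say, and is contained in each positive object intent that contains `H`; hence `S = H`. -/
theorem foldl_shrink_spec (h : HasNew P N known Finset.univ) :
    RowMinHyp P N (P.foldl (shrink P N known) Finset.univ) ∧
      P.foldl (shrink P N known) Finset.univ ∉ known := by
  obtain ⟨⟨H, h₁, h₂, h₃⟩, -, h₅⟩ := foldl_shrink P h
  have : P.foldl (shrink P N known) Finset.univ = H :=
    Finset.Subset.antisymm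
      (fun j hj => h₁.rowIntent j fun R hR hHR => h₅ H h₁ h₂ h₃ R hR hHR hj) h₃
  rw [this]
  exact ⟨h₁, h₂⟩

end Rows

/-! ### Programs for rows of cross-tables -/

/-- The registers with given flags `bad` and `ans`, and nothing else. -/
def Reg.flags (bad ans : Bool) : Reg := ⟨none, none, false, bad, ans⟩

@[simp] theorem Reg.flags_setCur_none (b a : Bool) :
    (Reg.flags b a).setCur none = Reg.flags b a := rfl

/-- The cell of an intersection of two rows. -/
def meetCell (a b : Letter) : Letter := if a = .cross ∧ b = .cross then .cross else .blank

/-- Every cross in the row `l'` is also one in the row `l`. -/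
def subWord (l l' : List Letter) : Bool :=
  (List.zipWith (fun a b => decide (b = Letter.cross → a = Letter.cross)) l l').all id

theorem zipWith_meetCell_cells {m : ℕ} (R S : Finset (Fin m)) :
    List.zipWith meetCell (cells R) (cells S) = cells (R ∩ S) := by
  refine List.ext_getElem (by simp [cells]) fun i _ _ => ?_
  simp only [cells, List.getElem_zipWith, List.getElem_ofFn, Finset.mem_inter, meetCell]
  split_ifs <;> simp_all

theorem subWord_cells {m : ℕ} (R S : Finset (Fin m)) :
    subWord (cells R) (cells S) = decide (S ⊆ R) := by
  have e : List.zipWith (fun a b => decide (b = Letter.cross → a = Letter.cross))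
      (cells R) (cells S) = List.ofFn fun j => decide (j ∈ S → j ∈ R) := by
    refine List.ext_getElem (by simp [cells]) fun i _ _ => ?_
    simp only [cells, List.getElem_zipWith, List.getElem_ofFn]
    split_ifs <;> simp_all
  rw [subWord, e, Bool.eq_iff_iff]
  simp only [List.all_eq_true, List.mem_ofFn, forall_exists_index, id, decide_eq_true_eq]
  constructor
  · intro h j hj
    exact of_decide_eq_true (h _ j rfl) hj
  · rintro h _ j rfl
    exact decide_eq_true (@h j)

@[simp] theorem rowsWord_nil {m : ℕ} : rowsWord ([] : List (Finset (Fin m))) = [] := rfl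

@[simp] theorem rowsWord_cons {m : ℕ} (S : Finset (Fin m)) (L : List (Finset (Fin m))) :
    rowsWord (S :: L) = cells S ++ .endRow :: rowsWord L := by
  simp [rowsWord]

@[simp] theorem rowsWord_append {m : ℕ} (L L' : List (Finset (Fin m))) :
    rowsWord (L ++ L') = rowsWord L ++ rowsWord L' := by
  simp [rowsWord]

theorem endRow_notMem_cells {m : ℕ} (S : Finset (Fin m)) : Letter.endRow ∉ cells S := by
  intro h
  simpa using mem_cells h

namespace Frag

variable {tm : FinTM2} {W : Type} [DecidableEq W]

/-- Intersect the next cell of a row, which has been read from `x`, with the next cell in `t`: put the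
result on `o` and the cell of `t` on `z`, update the flag `sub`, and read the next letter of `x`. -/
def interCell (x t o z : W) : Prog tm W :=
  (pop t fun r a => { r with
    aux := a
    sub := r.sub && decide (a = some Letter.cross → r.cur = some Letter.cross) }).seq <|
  (push z fun r => r.aux.getD .cross).seq <|
  (push o fun r => meetCell r.letter (r.aux.getD .cross)).seq <|
  popCur x

/-- Take the first row of the table in `x` away, and put its intersection with the row `t` in front
of `o`, in reverse order. The flag `bad` is set if the row in `x` contains the row `t`. The variable
`z` is used as scratch. -/
def interRow (x t o z : W) : Prog tm W :=
  (set fun r => { r with sub := true }).seq <|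
  (popCur x).seq <|
  (whileDo (fun r => decide (r.cur ≠ some .endRow)) (interCell x t o z)).seq <|
  (push o fun _ => .endRow).seq <|
  (set fun r => .flags (r.bad || r.sub) r.ans).seq <|
  move z t

theorem runs_interCell_loop {x t o z : W} (hxt : x ≠ t) (hxo : x ≠ o) (hxz : x ≠ z) (hto : t ≠ o)
    (htz : t ≠ z) (hoz : o ≠ z) (rest : List Letter) (l l' : List Letter)
    (hl : l.length = l'.length) (hend : .endRow ∉ l) (m : Mem tm W)
    (hx : m.w x = l ++ .endRow :: rest) (ht : m.w t = l') :
    ∃ a, (whileDo (fun r => decide (r.cur ≠ some .endRow)) (interCell x t o z)).Runs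
      (5 * l.length + 1)
      { m with r := m.r.setCur (m.w x).head?, w := update m.w x (m.w x).tail }
      { m with
        r := ⟨some .endRow, a, m.r.sub && subWord l l', m.r.bad, m.r.ans⟩
        w := update (update (update (update m.w x rest) t []) z (l'.reverse ++ m.w z)) o
          ((List.zipWith meetCell l l').reverse ++ m.w o) } := by
  induction l generalizing l' m with
  | nil =>
    obtain rfl : l' = [] := List.length_eq_zero_iff.1 hl.symm
    refine ⟨m.r.aux, (runs_whileDo_false (by simp [hx])).congr ?_ (by simp)⟩
    ext1 <;> try rfl
    · simp [hx, subWord, Reg.setCur]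
    · funext j
      by_cases h₁ : j = o
      · subst h₁; simp [hxo.symm]
      by_cases h₂ : j = z
      · subst h₂; simp [hxz.symm, hoz.symm]
      by_cases h₃ : j = t
      · subst h₃; simp [hxt.symm, htz, hto, ht]
      by_cases h₄ : j = x <;> simp [h₁, h₂, h₃, h₄, hx, hxt, hxo, hxz]
  | cons a l ih =>
    obtain _ | ⟨b, l'⟩ := l'
    · simp at hl
    simp only [List.mem_cons, not_or] at hend
    obtain ⟨a', h⟩ := ih l' (by simpa using hl) hend.2
      { m with
        r := ⟨some a, some b, m.r.sub && decide (b = Letter.cross → a = Letter.cross), m.r.bad,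
          m.r.ans⟩
        w := update (update (update (update m.w x (l ++ .endRow :: rest)) t l') z (b :: m.w z)) o
          (meetCell a b :: m.w o) }
      (by simp [hxt, hxo, hxz]) (by simp [htz, hto])
    refine ⟨a', (Runs.whileDo_true (by simp [hx, Ne.symm hend.1]) (b := _) (t := 4) ?_ h).congr
      ?_ ?_⟩
    · refine ((runs_pop ..).seq ((runs_push ..).seq ((runs_push ..).seq (runs_popCur ..)))).congr
        ?_ le_rfl
      ext1 <;> try rfl
      · simp [hx, ht, hxt, hxt.symm, hxo, hxz, Reg.setCur]
      · funext j
        by_cases h₁ : j = o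
        · subst h₁; simp [hx, ht, hxo, hxo.symm, hto.symm, hoz, hxt.symm, Reg.letter]
        by_cases h₂ : j = z
        · subst h₂; simp [hx, ht, hxz.symm, hoz.symm, hoz, hxt.symm, htz.symm]
        by_cases h₃ : j = t
        · subst h₃; simp [hx, ht, hxt.symm, htz, hto]
        by_cases h₄ : j = x <;> simp [h₁, h₂, h₃, h₄, hx, hxt, hxo, hxz]
    · ext1 <;> try rfl
      · simp [subWord, Bool.and_assoc]
      · funext j
        by_cases h₁ : j = o
        · subst h₁; simp
        by_cases h₂ : j = z
        · subst h₂; simp [hoz.symm]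
        by_cases h₃ : j = t
        · subst h₃; simp [htz, hto]
        by_cases h₄ : j = x <;> simp [h₁, h₂, h₃, h₄, hxt, hxo, hxz]
    · simp; omega

theorem runs_interRow {n : ℕ} {x t o z : W} (hxt : x ≠ t) (hxo : x ≠ o) (hxz : x ≠ z) (hto : t ≠ o)
    (htz : t ≠ z) (hoz : o ≠ z) (R S : Finset (Fin n)) (rest : List Letter) (m : Mem tm W)
    (hx : m.w x = cells R ++ .endRow :: rest) (ht : m.w t = cells S) (hz : m.w z = []) :
    (interRow x t o z).Runs (8 * n + 7) m
      { m with
        r := .flags (m.r.bad || decide (S ⊆ R)) m.r.ans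
        w := update (update m.w x rest) o (.endRow :: ((cells (R ∩ S)).reverse ++ m.w o)) } := by
  obtain ⟨a, h⟩ := runs_interCell_loop hxt hxo hxz hto htz hoz rest (cells R) (cells S)
    (by simp [length_cells]) (endRow_notMem_cells R) { m with r := { m.r with sub := true } } hx ht
  refine ((runs_set ..).seq <| (runs_popCur ..).seq <| h.seq <| (runs_push ..).seq <|
    (runs_set ..).seq <| runs_move htz.symm _).congr ?_ ?_
  · ext1 <;> try rfl
    · simp [subWord_cells]
    · funext j
      by_cases h₁ : j = o
      · subst h₁; simp [hto.symm, hoz, zipWith_meetCell_cells]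
      by_cases h₂ : j = z
      · subst h₂; simp [htz.symm, hoz.symm, hxz.symm, hz]
      by_cases h₃ : j = t
      · subst h₃; simp [hto, ht, hoz.symm, hxt.symm, htz, hz]
      by_cases h₄ : j = x <;> simp [h₁, h₂, h₃, h₄, hxt, hxo, hxz]
  · simp [hz, length_cells, hoz.symm]
    omega

/-- Take all rows of the table in `x` away, and put their intersections with the row `t` in front of
`o`, in reverse order. The flag `bad` is set if some row in `x` contains the row `t`. -/
def interTable (x t o z : W) : Prog tm W :=
  (peek x Reg.setCur).seq
    (whileDo (fun r => r.cur.isSome) ((interRow x t o z).seq (peek x Reg.setCur)))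

theorem runs_interTable {n : ℕ} {x t o z : W} (hxt : x ≠ t) (hxo : x ≠ o) (hxz : x ≠ z)
    (hto : t ≠ o) (htz : t ≠ z) (hoz : o ≠ z) (S : Finset (Fin n)) (L : List (Finset (Fin n)))
    (m : Mem tm W) (bad ans : Bool) (hr : m.r = .flags bad ans) (hx : m.w x = rowsWord L)
    (ht : m.w t = cells S) (hz : m.w z = []) :
    (interTable x t o z).Runs (9 * (rowsWord L).length + 2) m
      { m with
        r := .flags (bad || decide (∃ R ∈ L, S ⊆ R)) ans
        w := update (update m.w x []) o ((rowsWord (L.map (· ∩ S))).reverse ++ m.w o) } := by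
  have key : (whileDo (fun r => r.cur.isSome) ((interRow x t o z).seq (peek x Reg.setCur))).Runs
      (9 * (rowsWord L).length + 1) { m with r := m.r.setCur (m.w x).head? }
      { m with
        r := .flags (bad || decide (∃ R ∈ L, S ⊆ R)) ans
        w := update (update m.w x []) o ((rowsWord (L.map (· ∩ S))).reverse ++ m.w o) } := by
    induction L generalizing m bad with
    | nil =>
      refine (runs_whileDo_false (by simp [hx])).congr ?_ (by simp)
      have e : update m.w x [] = m.w := by rw [← rowsWord_nil (m := n), ← hx]; simp
      simp [hx, hr, e]
    | cons R L ih =>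
      rw [rowsWord_cons] at hx
      have h₁ := runs_interRow hxt hxo hxz hto htz hoz R S (rowsWord L)
        { m with r := m.r.setCur (m.w x).head? } hx ht hz
      have h₂ := ih { m with
        r := .flags (bad || decide (S ⊆ R)) ans
        w := update (update m.w x (rowsWord L)) o (.endRow :: ((cells (R ∩ S)).reverse ++ m.w o)) }
        _ rfl (by simp [hxo]) (by simp [hto, hxt.symm, ht]) (by simp [hoz.symm, hxz.symm, hz])
      have hb : m.r.bad = bad := by rw [hr]; rfl
      have ha : m.r.ans = ans := by rw [hr]; rfl
      simp only [Reg.setCur_bad, Reg.setCur_ans, hb, ha] at h₁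
      refine (Runs.whileDo_true ?_ (h₁.seq (runs_peek ..)) h₂).congr ?_ ?_
      · rcases hc : cells R with _ | ⟨a, l⟩ <;> simp [hx, hc]
      · simp [Bool.or_assoc, update_comm hxo]
      · simp [length_cells]
        omega
  exact ((runs_peek ..).seq key).congr rfl (by omega)

end Frag

/-! ### Enumerating minimal hypotheses by questions about additional ones -/

/-- The letter variables of the program for `MHE`: the input, which later holds questions and the
output; a full row; the positive and the negative table; the table of the minimal hypotheses found so
far; the candidate for the next one; the set of attributes on trial; the positive rows still to be
tried; and three variables for table operations. -/
inductive EnumVar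
  | inp
  | full
  | pos
  | neg
  | kn
  | cand
  | trial
  | todo
  | scan
  | out
  | tmp
  deriving DecidableEq

namespace EnumVar

instance : Fintype EnumVar where
  elems := {inp, full, pos, neg, kn, cand, trial, todo, scan, out, tmp}
  complete x := by cases x <;> simp

/-- The values of the letter variables. -/
def vals (i f p n k c t d s o z : List Letter) : EnumVar → List Letter
  | inp => i
  | full => f
  | pos => p
  | neg => n
  | kn => k
  | cand => c
  | trial => t
  | todo => d
  | scan => s
  | out => o
  | tmp => z

section

variable (i f p n k c t d s o z u : List Letter)

@[simp] theorem vals_inp : vals i f p n k c t d s o z inp = i := rfl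
@[simp] theorem vals_full : vals i f p n k c t d s o z full = f := rfl
@[simp] theorem vals_pos : vals i f p n k c t d s o z pos = p := rfl
@[simp] theorem vals_neg : vals i f p n k c t d s o z neg = n := rfl
@[simp] theorem vals_kn : vals i f p n k c t d s o z kn = k := rfl
@[simp] theorem vals_cand : vals i f p n k c t d s o z cand = c := rfl
@[simp] theorem vals_trial : vals i f p n k c t d s o z trial = t := rfl
@[simp] theorem vals_todo : vals i f p n k c t d s o z todo = d := rfl
@[simp] theorem vals_scan : vals i f p n k c t d s o z scan = s := rfl
@[simp] theorem vals_out : vals i f p n k c t d s o z out = o := rfl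
@[simp] theorem vals_tmp : vals i f p n k c t d s o z tmp = z := rfl

@[simp] theorem update_inp :
    update (vals i f p n k c t d s o z) inp u = vals u f p n k c t d s o z := by
  funext y; cases y <;> rfl
@[simp] theorem update_full :
    update (vals i f p n k c t d s o z) full u = vals i u p n k c t d s o z := by
  funext y; cases y <;> rfl
@[simp] theorem update_pos :
    update (vals i f p n k c t d s o z) pos u = vals i f u n k c t d s o z := by
  funext y; cases y <;> rfl
@[simp] theorem update_neg :
    update (vals i f p n k c t d s o z) neg u = vals i f p u k c t d s o z := by
  funext y; cases y <;> rfl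
@[simp] theorem update_kn :
    update (vals i f p n k c t d s o z) kn u = vals i f p n u c t d s o z := by
  funext y; cases y <;> rfl
@[simp] theorem update_cand :
    update (vals i f p n k c t d s o z) cand u = vals i f p n k u t d s o z := by
  funext y; cases y <;> rfl
@[simp] theorem update_trial :
    update (vals i f p n k c t d s o z) trial u = vals i f p n k c u d s o z := by
  funext y; cases y <;> rfl
@[simp] theorem update_todo :
    update (vals i f p n k c t d s o z) todo u = vals i f p n k c t u s o z := by
  funext y; cases y <;> rfl
@[simp] theorem update_scan :
    update (vals i f p n k c t d s o z) scan u = vals i f p n k c t d u o z := by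
  funext y; cases y <;> rfl
@[simp] theorem update_out :
    update (vals i f p n k c t d s o z) out u = vals i f p n k c t d s u z := by
  funext y; cases y <;> rfl
@[simp] theorem update_tmp :
    update (vals i f p n k c t d s o z) tmp u = vals i f p n k c t d s o u := by
  funext y; cases y <;> rfl

end

end EnumVar

namespace Frag

open EnumVar

variable {tm : FinTM2}

/-- Ask the simulated machine whether there is a further minimal hypothesis contained in the set in
`trial`. The question is put together in `inp`, from its end to its beginning. -/
def ask (f : Letter → tm.Γ tm.k₀) (g : tm.Γ tm.k₁ → Bool) : Prog tm EnumVar :=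
  (push inp fun _ => .endTable).seq <| (prepend kn inp tmp).seq <|
  (push inp fun _ => .endTable).seq <| (prepend neg inp tmp).seq <|
  (push inp fun _ => .endTable).seq <| (prepend kn inp tmp).seq <|
  (prepend pos scan tmp).seq <| (interTable scan trial out tmp).seq <| (move out inp).seq <|
  (push inp fun _ => .endRow).seq <| (prepend trial inp tmp).seq <|
  (push inp fun _ => .endRow).seq <| (prepend full inp tmp).seq <|
  (move inp tmp).seq <| (feed tmp tm.k₀ f).seq <| (simulate tm EnumVar).seq <|
  (popSim tm.k₁ fun _ o => .flags false ((o.map g).getD false))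

/-- A bound for the time of `ask`. -/
def askTime (p : Polynomial ℕ) (l : ℕ) : ℕ := p.eval (6 * l + 5) + 100 * l + 100

/-- The memory between the operations of the program for `MHE`. -/
def enumMem (tm : FinTM2) {m : ℕ} (P N known : List (Finset (Fin m))) (r : Reg)
    (c t d : List Letter) : Mem tm EnumVar :=
  ⟨tm.initialState, fun _ => [], [], r, vals [] (cells (Finset.univ : Finset (Fin m)))
    (rowsWord P) (rowsWord N) (rowsWord known) c t d [] [] []⟩

section

variable (hA : TM2ComputableInPolyTime encodeAMH Computability.encodeBool
  fun x => @decide (AMH x) (Classical.propDecidable _))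

/-- The program `ask` gives the right answer. It asks about the contexts of `exists_amhInstance`, and
the length of this question is at most `6 * l + 5`. -/
theorem runs_ask {m l : ℕ} {P N known : List (Finset (Fin m))} {T : Finset (Fin m)}
    (hT : RowIntent P T) (hTN : T = Finset.univ ∨ ∀ R ∈ N, ¬ T ⊆ R)
    (hk : ∀ H ∈ known, RowMinHyp P N H) (hkn : known.Nodup) (hm : m ≤ l)
    (hP : (rowsWord P).length ≤ l) (hN : (rowsWord N).length ≤ l)
    (hkl : (rowsWord known).length ≤ l) (b a : Bool) (c d : List Letter) :
    (ask hA.inputAlphabet.invFun hA.outputAlphabet).Runs (askTime hA.time l)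
      (enumMem hA.tm P N known (.flags b a) c (cells T) d)
      (enumMem hA.tm P N known
        (.flags false (@decide (HasNew P N known T) (Classical.propDecidable _))) c (cells T) d) := by
  obtain ⟨x, hx, hw⟩ := exists_amhInstance hT hTN hk hkn
  have hrun := hA.outputsFun x
  set F := cells (Finset.univ : Finset (Fin m))
  set Pw := rowsWord P
  set Nw := rowsWord N
  set Kw := rowsWord known
  have hF : F.length = m := length_cells _
  have hT' : (cells T).length = m := length_cells _
  have hPT : (rowsWord (P.map (· ∩ T))).length = Pw.length := by
    simp only [Pw, length_rowsWord, List.length_map]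
  -- `w₀`, `w₁`, `w₂`, `w₃` are the parts of the question that begin with the rows for `P`, with the
  -- known hypotheses in the positive table, with the negative table, and with the final list
  set w₃ := Kw ++ [Letter.endTable] with hw₃
  set w₂ := Nw ++ .endTable :: w₃ with hw₂
  set w₁ := Kw ++ .endTable :: w₂ with hw₁
  set w₀ := rowsWord (P.map (· ∩ T)) ++ w₁ with hw₀
  set v := F ++ .endRow :: (cells T ++ .endRow :: w₀) with hv
  have hxv : encodeAMH x = v := by
    rw [hw, auxRows, rowsWord_cons, rowsWord_append]
    simp [hv, hw₀, hw₁, hw₂, hw₃, F, Kw, Nw]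
  have hvl : v.length ≤ 6 * l + 5 := by
    simp only [hv, hw₀, hw₁, hw₂, hw₃, List.length_append, List.length_cons, List.length_nil, hPT,
      hF, hT']
    omega
  let M (i t s o z : List Letter) (r : Reg) : Mem hA.tm EnumVar :=
    ⟨hA.tm.initialState, fun _ => [], [], r, vals i F Pw Nw Kw c t d s o z⟩
  have r₁ := runs_push inp (fun _ => .endTable) (M [] (cells T) [] [] [] (.flags b a))
  have r₂ := runs_prepend (x := kn) (y := inp) (z := tmp) (by decide) (by decide) (by decide)
    (M [.endTable] (cells T) [] [] [] (.flags b a)) rfl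
  have r₃ := runs_push inp (fun _ => .endTable) (M w₃ (cells T) [] [] [] (.flags b a))
  have r₄ := runs_prepend (x := neg) (y := inp) (z := tmp) (by decide) (by decide) (by decide)
    (M (.endTable :: w₃) (cells T) [] [] [] (.flags b a)) rfl
  have r₅ := runs_push inp (fun _ => .endTable) (M w₂ (cells T) [] [] [] (.flags b a))
  have r₆ := runs_prepend (x := kn) (y := inp) (z := tmp) (by decide) (by decide) (by decide)
    (M (.endTable :: w₂) (cells T) [] [] [] (.flags b a)) rfl
  have r₇ := runs_prepend (x := pos) (y := scan) (z := tmp) (by decide) (by decide) (by decide)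
    (M w₁ (cells T) [] [] [] (.flags b a)) rfl
  have r₈ := runs_interTable (x := scan) (t := trial) (o := out) (z := tmp) (by decide)
    (by decide) (by decide) (by decide) (by decide) (by decide) T P
    (M w₁ (cells T) Pw [] [] (.flags b a)) b a rfl rfl rfl rfl
  have r₉ := runs_move (x := out) (y := inp) (by decide)
    (M w₁ (cells T) [] (rowsWord (P.map (· ∩ T))).reverse []
      (.flags (b || decide (∃ R ∈ P, T ⊆ R)) a))
  have r₁₀ := runs_push inp (fun _ => .endRow)
    (M w₀ (cells T) [] [] [] (.flags (b || decide (∃ R ∈ P, T ⊆ R)) a))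
  have r₁₁ := runs_prepend (x := trial) (y := inp) (z := tmp) (by decide) (by decide) (by decide)
    (M (.endRow :: w₀) (cells T) [] [] [] (.flags (b || decide (∃ R ∈ P, T ⊆ R)) a)) rfl
  have r₁₂ := runs_push inp (fun _ => .endRow) (M (cells T ++ .endRow :: w₀) (cells T) [] [] []
    (.flags (b || decide (∃ R ∈ P, T ⊆ R)) a))
  have r₁₃ := runs_prepend (x := full) (y := inp) (z := tmp) (by decide) (by decide) (by decide)
    (M (.endRow :: (cells T ++ .endRow :: w₀)) (cells T) [] [] []
      (.flags (b || decide (∃ R ∈ P, T ⊆ R)) a)) rfl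
  have r₁₄ := runs_move (x := inp) (y := tmp) (by decide)
    (M v (cells T) [] [] [] (.flags (b || decide (∃ R ∈ P, T ⊆ R)) a))
  have r₁₅ := runs_feed tmp hA.tm.k₀ hA.inputAlphabet.invFun
    (M [] (cells T) [] [] v.reverse (.flags (b || decide (∃ R ∈ P, T ⊆ R)) a))
  have r₁₆ := runs_simulate hrun
    ⟨hA.tm.initialState, update (fun _ => []) hA.tm.k₀ (v.map hA.inputAlphabet.invFun), [],
      .flags (b || decide (∃ R ∈ P, T ⊆ R)) a, vals [] F Pw Nw Kw c (cells T) d [] [] []⟩ rfl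
    (by rw [hxv])
  rw [hxv] at r₁₆
  simp only [M, vals_inp, vals_full, vals_pos, vals_neg, vals_kn, vals_trial, vals_scan, vals_out,
    vals_tmp, update_inp, update_scan, update_out, update_tmp, Reg.flags_setCur_none,
    List.append_nil, List.reverse_reverse, Pw] at r₁ r₂ r₃ r₄ r₅ r₆ r₇ r₈ r₉ r₁₀ r₁₁ r₁₂ r₁₃ r₁₄ r₁₅
  refine (r₁.seq <| r₂.seq <| r₃.seq <| r₄.seq <| r₅.seq <| r₆.seq <| r₇.seq <| r₈.seq <|
    r₉.seq <| r₁₀.seq <| r₁₁.seq <| r₁₂.seq <| r₁₃.seq <| r₁₄.seq <| r₁₅.seq <|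
    r₁₆.seq <| runs_popSim ..).congr ?_ ?_
  · have e : (@decide (AMH x) (Classical.propDecidable _)) =
        @decide (HasNew P N known T) (Classical.propDecidable _) := decide_eq_decide.2 hx
    simp [enumMem, e, Computability.encodeBool, F, Pw, Nw, Kw]
  · have ht := eval_mono hA.time hvl
    simp only [List.length_reverse, hPT, hF, hT', askTime]
    change Pw.length ≤ l at hP
    linarith only [hP, hN, hkl, hm, hvl, ht]

end

/-- Replace the candidate by its intersection with the next row of `todo`, if this contains a further
minimal hypothesis. If a negative example has all the attributes in the intersection, the machine is
not asked. -/
def tryRow (f : Letter → tm.Γ tm.k₀) (g : tm.Γ tm.k₁ → Bool) : Prog tm EnumVar :=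
  (interRow todo cand out tmp).seq <| (popCur out).seq <| (move out trial).seq <|
  (set fun r => .flags false r.ans).seq <| (prepend neg scan tmp).seq <|
  (interTable scan trial out tmp).seq <| (clear out).seq <|
  (ite Reg.bad (set fun _ => .flags false false) (ask f g)).seq <|
  (ite Reg.ans ((clear cand).seq (prepend trial cand tmp)) (set id)).seq <| clear trial

/-- A bound for the time of `tryRow`. -/
def tryTime (p : Polynomial ℕ) (l : ℕ) : ℕ := askTime p l + 50 * l + 50

/-- Find a further minimal hypothesis, and add it to the list. -/
def search (f : Letter → tm.Γ tm.k₀) (g : tm.Γ tm.k₁ → Bool) : Prog tm EnumVar :=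
  (prepend pos todo tmp).seq <| (prepend full cand tmp).seq <|
  (peek todo Reg.setCur).seq <|
  (whileDo (fun r => r.cur.isSome) ((tryRow f g).seq (peek todo Reg.setCur))).seq <|
  (push kn fun _ => .endRow).seq <| (prepend cand kn tmp).seq <| clear cand

/-- A bound for the time of `search`. -/
def searchTime (p : Polynomial ℕ) (l : ℕ) : ℕ := l * (tryTime p l + 2) + 24 * l + 17

/-- Ask whether there is any further minimal hypothesis. -/
def askFull (f : Letter → tm.Γ tm.k₀) (g : tm.Γ tm.k₁ → Bool) : Prog tm EnumVar :=
  (prepend full trial tmp).seq <| (ask f g).seq <| clear trial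

/-- A bound for the time of `askFull`. -/
def askFullTime (p : Polynomial ℕ) (l : ℕ) : ℕ := askTime p l + 10 * l + 6

/-- The program for `MHE`. -/
def enumProg (f : Letter → tm.Γ tm.k₀) (g : tm.Γ tm.k₁ → Bool) : Prog tm EnumVar :=
  -- separate the parts of the input
  (takeUntil .endRow inp tmp).seq <| (move tmp full).seq <|
  (takeUntil .endTable inp tmp).seq <| (move tmp pos).seq <|
  (takeUntil .endTable inp tmp).seq <| (move tmp neg).seq <|
  -- enumerate the minimal hypotheses
  (askFull f g).seq <| (whileDo Reg.ans ((search f g).seq (askFull f g))).seq <|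
  -- write the output and clean up
  (push inp fun _ => .endTable).seq <| (prepend kn inp tmp).seq <|
  (clear full).seq <| (clear pos).seq <| (clear neg).seq <| (clear kn).seq reset

/-- A bound for the time of the program for `MHE`. -/
def enumTime (p : Polynomial ℕ) (l : ℕ) : ℕ :=
  askFullTime p l + l * (searchTime p l + askFullTime p l + 1) + 50 * l + 50

theorem polyBounded_askTime (p : Polynomial ℕ) : PolyBounded (askTime p) :=
  ((PolyBounded.eval_comp p (((PolyBounded.const 6).mul .id).add (.const 5))).add
    ((PolyBounded.const 100).mul .id)).add (.const 100)

theorem polyBounded_enumTime (p : Polynomial ℕ) : PolyBounded (enumTime p) := by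
  have h₁ := polyBounded_askTime p
  have h₂ : PolyBounded (tryTime p) := (h₁.add ((PolyBounded.const 50).mul .id)).add (.const 50)
  have h₃ : PolyBounded (askFullTime p) := (h₁.add ((PolyBounded.const 10).mul .id)).add (.const 6)
  have h₄ : PolyBounded (searchTime p) := ((PolyBounded.id.mul (h₂.add (.const 2))).add
    ((PolyBounded.const 24).mul .id)).add (.const 17)
  exact ((h₃.add (PolyBounded.id.mul ((h₄.add h₃).add (.const 1)))).add
    ((PolyBounded.const 50).mul .id)).add (.const 50)

section

variable (hA : TM2ComputableInPolyTime encodeAMH Computability.encodeBool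
  fun x => @decide (AMH x) (Classical.propDecidable _))

/-- The program `tryRow` computes `shrink`. -/
theorem runs_tryRow {m l : ℕ} {P N known : List (Finset (Fin m))} {S R : Finset (Fin m)}
    (hS : RowIntent P S) (hR : R ∈ P)
    (hk : ∀ H ∈ known, RowMinHyp P N H) (hkn : known.Nodup) (hm : m ≤ l)
    (hP : (rowsWord P).length ≤ l) (hN : (rowsWord N).length ≤ l)
    (hkl : (rowsWord known).length ≤ l) (r : Reg) (rest : List Letter) :
    ∃ a, (tryRow hA.inputAlphabet.invFun hA.outputAlphabet).Runs (tryTime hA.time l)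
      (enumMem hA.tm P N known r (cells S) [] (cells R ++ .endRow :: rest))
      (enumMem hA.tm P N known (.flags false a) (cells (shrink P N known S R)) [] rest) := by
  have hmS : (cells S).length = m := length_cells _
  have hmT : (cells (R ∩ S)).length = m := length_cells _
  have hNT : (rowsWord (N.map (· ∩ (R ∩ S)))).length = (rowsWord N).length := by
    simp only [length_rowsWord, List.length_map]
  set b := decide (∃ R' ∈ N, R ∩ S ⊆ R') with hb
  let M (t d s o : List Letter) (r : Reg) : Mem hA.tm EnumVar :=
    ⟨hA.tm.initialState, fun _ => [], [], r, vals [] (cells (Finset.univ : Finset (Fin m)))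
      (rowsWord P) (rowsWord N) (rowsWord known) (cells S) t d s o []⟩
  have r₁ := runs_interRow (x := todo) (t := cand) (o := out) (z := tmp) (by decide) (by decide)
    (by decide) (by decide) (by decide) (by decide) R S rest
    (M [] (cells R ++ .endRow :: rest) [] [] r) rfl rfl rfl
  have r₂ := runs_popCur out (M [] rest [] (.endRow :: (cells (R ∩ S)).reverse)
    (.flags (r.bad || decide (S ⊆ R)) r.ans))
  have r₃ := runs_move (x := out) (y := trial) (by decide) (M [] rest [] (cells (R ∩ S)).reverse
    ((Reg.flags (r.bad || decide (S ⊆ R)) r.ans).setCur (some .endRow)))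
  have r₄ := runs_set (fun r => .flags false r.ans) (M (cells (R ∩ S)) rest [] []
    (.flags (r.bad || decide (S ⊆ R)) r.ans))
  have r₅ := runs_prepend (x := neg) (y := scan) (z := tmp) (by decide) (by decide) (by decide)
    (M (cells (R ∩ S)) rest [] [] (.flags false r.ans)) rfl
  have r₆ := runs_interTable (x := scan) (t := trial) (o := out) (z := tmp) (by decide)
    (by decide) (by decide) (by decide) (by decide) (by decide) (R ∩ S) N
    (M (cells (R ∩ S)) rest (rowsWord N) [] (.flags false r.ans)) false r.ans rfl rfl rfl rfl
  have r₇ := runs_clear out (M (cells (R ∩ S)) rest []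
    (rowsWord (N.map (· ∩ (R ∩ S)))).reverse (.flags b r.ans))
  simp only [M, vals_neg, vals_trial, vals_scan, vals_out, update_trial, update_todo,
    update_scan, update_out, Reg.flags_setCur_none, Reg.setCur_setCur, List.append_nil,
    List.reverse_reverse, List.tail_cons, List.head?_cons, Bool.false_or, ← hb]
    at r₁ r₂ r₃ r₄ r₅ r₆ r₇
  obtain ⟨a, r₈, ha⟩ : ∃ a, (ite Reg.bad (set fun _ => .flags false false)
      (ask hA.inputAlphabet.invFun hA.outputAlphabet)).Runs (askTime hA.time l + 1)
      (enumMem hA.tm P N known (.flags b r.ans) (cells S) (cells (R ∩ S)) rest)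
      (enumMem hA.tm P N known (.flags false a) (cells S) (cells (R ∩ S)) rest) ∧
      shrink P N known S R = if a then R ∩ S else S := by
    by_cases h : ∃ R' ∈ N, R ∩ S ⊆ R'
    · refine ⟨false, Runs.ite_true (by simp [enumMem, Reg.flags, hb, h])
        ((runs_set ..).congr rfl (by simp [askTime])), ?_⟩
      -- if the further minimal hypothesis is the full set, then the candidate does not change
      simp only [shrink, Bool.false_eq_true, if_false]
      split_ifs with hn
      · obtain ⟨R', hR', h'⟩ := h
        rw [Finset.inter_comm] at h'
        have e := hn.eq_univ hR' h'
        rw [e]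
        exact (Finset.univ_subset_iff.1 (e ▸ Finset.inter_subset_left)).symm
      · rfl
    · refine ⟨@decide (HasNew P N known (R ∩ S)) (Classical.propDecidable _),
        Runs.ite_false (by simp [enumMem, Reg.flags, hb, h]) (runs_ask hA
          ((rowIntent_of_mem hR).inter hS) (.inr (by simpa using h)) hk hkn hm hP hN hkl _ _ _ _),
        ?_⟩
      rw [Finset.inter_comm R S]
      by_cases hn : HasNew P N known (S ∩ R) <;> simp [shrink, hn]
  have r₉ : (ite Reg.ans ((clear cand).seq (prepend trial cand tmp)) (set id)).Runs (10 * m + 7)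
      (enumMem hA.tm P N known (.flags false a) (cells S) (cells (R ∩ S)) rest)
      (enumMem hA.tm P N known (.flags false a) (cells (shrink P N known S R)) (cells (R ∩ S))
        rest) := by
    cases a with
    | true =>
      refine Runs.congr (Runs.ite_true rfl ((runs_clear ..).seq
        (runs_prepend (by decide) (by decide) (by decide) _ ?_))) ?_ ?_
      · simp [enumMem]
      · simp [enumMem, ha]
      · simp [enumMem, hmS, hmT]; omega
    | false =>
      refine Runs.congr (Runs.ite_false rfl (runs_set ..)) ?_ (by omega)
      simp [enumMem, ha]
  have r₁₀ := runs_clear trial (enumMem hA.tm P N known (.flags false a)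
    (cells (shrink P N known S R)) (cells (R ∩ S)) rest)
  refine ⟨a, (r₁.seq <| r₂.seq <| r₃.seq <| r₄.seq <| r₅.seq <| r₆.seq <| r₇.seq <| r₈.seq <|
    r₉.seq r₁₀).congr ?_ ?_⟩
  · simp [enumMem]
  · simp only [enumMem, vals_trial, List.length_reverse, hNT, hmT, tryTime]
    linarith only [hN, hm]

theorem runs_askFull {m l : ℕ} {P N known : List (Finset (Fin m))}
    (hk : ∀ H ∈ known, RowMinHyp P N H) (hkn : known.Nodup) (hm : m ≤ l)
    (hP : (rowsWord P).length ≤ l) (hN : (rowsWord N).length ≤ l)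
    (hkl : (rowsWord known).length ≤ l) (b a : Bool) :
    (askFull hA.inputAlphabet.invFun hA.outputAlphabet).Runs (askFullTime hA.time l)
      (enumMem hA.tm P N known (.flags b a) [] [] [])
      (enumMem hA.tm P N known (.flags false
        (@decide (HasNew P N known Finset.univ) (Classical.propDecidable _))) [] [] []) := by
  have hF : (cells (Finset.univ : Finset (Fin m))).length = m := length_cells _
  have r₁ := runs_prepend (x := full) (y := trial) (z := tmp) (by decide) (by decide) (by decide)
    (enumMem hA.tm P N known (.flags b a) [] [] []) rfl
  have r₂ := runs_ask hA (rowIntent_univ (P := P)) (.inl rfl) hk hkn hm hP hN hkl b a [] []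
  have r₃ := runs_clear trial (enumMem hA.tm P N known (.flags false
    (@decide (HasNew P N known Finset.univ) (Classical.propDecidable _))) []
      (cells (Finset.univ : Finset (Fin m))) [])
  simp only [enumMem, vals_full, vals_trial, update_trial, Reg.flags_setCur_none,
    List.append_nil] at r₁ r₂ r₃
  refine (r₁.seq <| r₂.seq r₃).congr rfl ?_
  rw [hF, askFullTime]
  linarith only [hm]

theorem runs_tryRow_loop {m l : ℕ} {P N known : List (Finset (Fin m))}
    (hk : ∀ H ∈ known, RowMinHyp P N H) (hkn : known.Nodup) (hm : m ≤ l)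
    (hP : (rowsWord P).length ≤ l) (hN : (rowsWord N).length ≤ l)
    (hkl : (rowsWord known).length ≤ l) (L : List (Finset (Fin m))) (hL : L ⊆ P)
    (S : Finset (Fin m)) (hS : RowIntent P S) (a : Bool) :
    ∃ a', (whileDo (fun r => r.cur.isSome)
        ((tryRow hA.inputAlphabet.invFun hA.outputAlphabet).seq (peek todo Reg.setCur))).Runs
      (L.length * (tryTime hA.time l + 2) + 1)
      (enumMem hA.tm P N known ((Reg.flags false a).setCur (rowsWord L).head?) (cells S) []
        (rowsWord L))
      (enumMem hA.tm P N known (.flags false a') (cells (L.foldl (shrink P N known) S)) [] []) := by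
  induction L generalizing S a with
  | nil => exact ⟨a, (runs_whileDo_false rfl).congr rfl (by simp)⟩
  | cons R L ih =>
    obtain ⟨hR, hL⟩ := List.cons_subset.1 hL
    obtain ⟨a₁, h₁⟩ := runs_tryRow hA hS hR hk hkn hm hP hN hkl
      ((Reg.flags false a).setCur (rowsWord (R :: L)).head?) (rowsWord L)
    obtain ⟨a₂, h₂⟩ := ih hL _ (hS.shrink (N := N) (known := known) hR) a₁
    rw [← rowsWord_cons] at h₁
    refine ⟨a₂, (Runs.whileDo_true ?_ (h₁.seq (runs_peek ..)) h₂).congr rfl ?_⟩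
    · rcases hc : cells R with _ | ⟨x, u⟩ <;> simp [enumMem, hc]
    · rw [List.length_cons, Nat.succ_mul]
      omega

/-- The program `search` adds the set that is found by `foldl_shrink_spec` to the list. -/
theorem runs_search {m l : ℕ} {P N known : List (Finset (Fin m))}
    (hk : ∀ H ∈ known, RowMinHyp P N H) (hkn : known.Nodup) (hm : m ≤ l)
    (hP : (rowsWord P).length ≤ l) (hN : (rowsWord N).length ≤ l)
    (hkl : (rowsWord known).length ≤ l) (a : Bool) :
    ∃ a', (search hA.inputAlphabet.invFun hA.outputAlphabet).Runs (searchTime hA.time l)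
      (enumMem hA.tm P N known (.flags false a) [] [] [])
      (enumMem hA.tm P N (P.foldl (shrink P N known) Finset.univ :: known) (.flags false a')
        [] [] []) := by
  set S := P.foldl (shrink P N known) Finset.univ with hS
  have hPl : P.length ≤ l := by
    refine le_trans ?_ hP
    rw [length_rowsWord]
    exact Nat.le_mul_of_pos_right _ (by omega)
  obtain ⟨a', r₃⟩ := runs_tryRow_loop hA hk hkn hm hP hN hkl P (List.Subset.refl P) Finset.univ
    rowIntent_univ a
  have hF : (cells (Finset.univ : Finset (Fin m))).length = m := length_cells _
  have hmS : (cells S).length = m := length_cells _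
  let M (k c d : List Letter) (r : Reg) : Mem hA.tm EnumVar :=
    ⟨hA.tm.initialState, fun _ => [], [], r, vals [] (cells (Finset.univ : Finset (Fin m)))
      (rowsWord P) (rowsWord N) k c [] d [] [] []⟩
  have r₁ := runs_prepend (x := pos) (y := todo) (z := tmp) (by decide) (by decide) (by decide)
    (M (rowsWord known) [] [] (.flags false a)) rfl
  have r₂ := runs_prepend (x := full) (y := cand) (z := tmp) (by decide) (by decide) (by decide)
    (M (rowsWord known) [] (rowsWord P) (.flags false a)) rfl
  have r₂' := runs_peek todo Reg.setCur (M (rowsWord known)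
    (cells (Finset.univ : Finset (Fin m))) (rowsWord P) (.flags false a))
  have r₄ := runs_push kn (fun _ => .endRow) (M (rowsWord known) (cells S) [] (.flags false a'))
  have r₅ := runs_prepend (x := cand) (y := kn) (z := tmp) (by decide) (by decide) (by decide)
    (M (.endRow :: rowsWord known) (cells S) [] (.flags false a')) rfl
  have r₆ := runs_clear cand (M (cells S ++ .endRow :: rowsWord known) (cells S) []
    (.flags false a'))
  simp only [M, vals_full, vals_pos, vals_kn, vals_cand, vals_todo, update_cand, update_kn,
    update_todo, Reg.flags_setCur_none, List.append_nil] at r₁ r₂ r₂' r₄ r₅ r₆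
  refine ⟨a', (r₁.seq <| r₂.seq <| r₂'.seq <| r₃.seq <| r₄.seq <| r₅.seq r₆).congr ?_ ?_⟩
  · simp [enumMem]
  · have := Nat.mul_le_mul_right (tryTime hA.time l + 2) hPl
    rw [hF, hmS, searchTime]
    linarith only [this, hm, hP]

open Classical in
/-- The loop that adds a further minimal hypothesis to the list as long as there is one, if `k` of
them are still missing. -/
theorem runs_search_loop {m l : ℕ} {P N : List (Finset (Fin m))} (hm : m ≤ l)
    (hP : (rowsWord P).length ≤ l) (hN : (rowsWord N).length ≤ l)
    (hl : (Finset.univ.filter (RowMinHyp P N)).card * (m + 1) ≤ l) (k : ℕ)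
    (known : List (Finset (Fin m))) (hk : ∀ H ∈ known, RowMinHyp P N H) (hkn : known.Nodup)
    (hc : (Finset.univ.filter (RowMinHyp P N)).card = known.length + k) :
    ∃ L : List (Finset (Fin m)), L.Nodup ∧ (∀ H, H ∈ L ↔ RowMinHyp P N H) ∧
      (whileDo Reg.ans ((search hA.inputAlphabet.invFun hA.outputAlphabet).seq
        (askFull hA.inputAlphabet.invFun hA.outputAlphabet))).Runs
        (k * (searchTime hA.time l + askFullTime hA.time l + 1) + 1)
        (enumMem hA.tm P N known (.flags false (decide (HasNew P N known Finset.univ))) [] [] [])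
        (enumMem hA.tm P N L (.flags false false) [] [] []) := by
  have hkl : (rowsWord known).length ≤ l := by
    rw [length_rowsWord]
    exact (Nat.mul_le_mul_right _ (by omega)).trans hl
  have hsub : known.toFinset ⊆ Finset.univ.filter (RowMinHyp P N) := by
    intro H hH
    simpa using hk H (List.mem_toFinset.1 hH)
  have hcard : known.toFinset.card = known.length := List.toFinset_card_of_nodup hkn
  by_cases hn : HasNew P N known Finset.univ
  · obtain ⟨h₁, h₂⟩ := foldl_shrink_spec hn
    set S := P.foldl (shrink P N known) Finset.univ
    have hk' : ∀ H ∈ S :: known, RowMinHyp P N H := List.forall_mem_cons.2 ⟨h₁, hk⟩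
    have hkn' : (S :: known).Nodup := List.nodup_cons.2 ⟨h₂, hkn⟩
    have hle : (S :: known).length ≤ (Finset.univ.filter (RowMinHyp P N)).card := by
      rw [← List.toFinset_card_of_nodup hkn']
      refine Finset.card_le_card fun H hH => ?_
      simpa using hk' H (List.mem_toFinset.1 hH)
    have hkl' : (rowsWord (S :: known)).length ≤ l := by
      rw [length_rowsWord]
      exact (Nat.mul_le_mul_right _ hle).trans hl
    cases k with
    | zero =>
      rw [List.length_cons] at hle
      omega
    | succ k =>
      obtain ⟨L, hL₁, hL₂, r₃⟩ := runs_search_loop hm hP hN hl k (S :: known) hk' hkn'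
        (by rw [List.length_cons]; omega)
      obtain ⟨a, r₁⟩ := runs_search hA hk hkn hm hP hN hkl true
      have r₂ := runs_askFull hA hk' hkn' hm hP hN hkl' false a
      refine ⟨L, hL₁, hL₂, ?_⟩
      rw [decide_eq_true hn]
      refine (Runs.whileDo_true rfl (r₁.seq r₂) r₃).congr rfl ?_
      rw [Nat.succ_mul]
      omega
  · refine ⟨known, hkn, fun H => ⟨hk H, fun hH => ?_⟩, ?_⟩
    · by_contra hno
      exact hn ⟨H, hH, hno, Finset.subset_univ H⟩
    · rw [decide_eq_false hn]
      exact (runs_whileDo_false rfl).congr rfl (by omega)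

open Classical in
/-- The program for `MHE` writes a list of all minimal hypotheses. The parameter `l` bounds the lengths
of the input and of the output. -/
theorem runs_enumProg {m l : ℕ} {P N : List (Finset (Fin m))} (hm : m ≤ l)
    (hP : (rowsWord P).length ≤ l) (hN : (rowsWord N).length ≤ l)
    (hl : (Finset.univ.filter (RowMinHyp P N)).card * (m + 1) ≤ l) :
    ∃ L : List (Finset (Fin m)), L.Nodup ∧ (∀ H, H ∈ L ↔ RowMinHyp P N H) ∧
      (enumProg hA.inputAlphabet.invFun hA.outputAlphabet).Runs (enumTime hA.time l)
        ⟨hA.tm.initialState, fun _ => [], [], Reg.init,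
          vals (cells (Finset.univ : Finset (Fin m)) ++ .endRow ::
            (rowsWord P ++ .endTable :: (rowsWord N ++ [.endTable]))) [] [] [] [] [] [] [] [] [] []⟩
        ⟨hA.tm.initialState, fun _ => [], [], Reg.init,
          vals (encodeSets L) [] [] [] [] [] [] [] [] [] []⟩ := by
  set c := (Finset.univ.filter (RowMinHyp P N)).card
  have hcl : c ≤ l := (Nat.le_mul_of_pos_right _ (Nat.succ_pos m)).trans hl
  obtain ⟨L, hL₁, hL₂, r₈⟩ := runs_search_loop hA hm hP hN hl c [] (by simp) List.nodup_nil
    (by simp [c])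
  have r₇ := runs_askFull hA (P := P) (N := N) (known := []) (l := l) (by simp) List.nodup_nil hm
    hP hN (by simp) false false
  have hLl : (rowsWord L).length ≤ l := by
    have : L.toFinset = Finset.univ.filter (RowMinHyp P N) := by
      ext H
      simp [hL₂]
    rw [length_rowsWord, ← List.toFinset_card_of_nodup hL₁, this]
    exact hl
  refine ⟨L, hL₁, hL₂, ?_⟩
  set F := cells (Finset.univ : Finset (Fin m)) with hF
  have hFl : F.length = m := length_cells _
  let M (i f p n z : List Letter) : Mem hA.tm EnumVar :=
    ⟨hA.tm.initialState, fun _ => [], [], .flags false false, vals i f p n [] [] [] [] [] [] z⟩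
  have r₁ := runs_takeUntil (c := .endRow) (x := inp) (y := tmp) (by decide)
    (M (F ++ .endRow :: (rowsWord P ++ .endTable :: (rowsWord N ++ [.endTable]))) [] [] [] []) F _
    rfl (endRow_notMem_cells _)
  have r₂ := runs_move (x := tmp) (y := full) (by decide)
    (M (rowsWord P ++ .endTable :: (rowsWord N ++ [.endTable])) [] [] [] F.reverse)
  have r₃ := runs_takeUntil (c := .endTable) (x := inp) (y := tmp) (by decide)
    (M (rowsWord P ++ .endTable :: (rowsWord N ++ [.endTable])) F [] [] []) (rowsWord P) _
    rfl (endTable_notMem_rowsWord _)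
  have r₄ := runs_move (x := tmp) (y := pos) (by decide)
    (M (rowsWord N ++ [.endTable]) F [] [] (rowsWord P).reverse)
  have r₅ := runs_takeUntil (c := .endTable) (x := inp) (y := tmp) (by decide)
    (M (rowsWord N ++ [.endTable]) F (rowsWord P) [] []) (rowsWord N) []
    rfl (endTable_notMem_rowsWord _)
  have r₆ := runs_move (x := tmp) (y := neg) (by decide)
    (M [] F (rowsWord P) [] (rowsWord N).reverse)
  let M' (i f p n k : List Letter) : Mem hA.tm EnumVar :=
    ⟨hA.tm.initialState, fun _ => [], [], .flags false false, vals i f p n k [] [] [] [] [] []⟩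
  have r₉ := runs_push inp (fun _ => .endTable) (M' [] F (rowsWord P) (rowsWord N) (rowsWord L))
  have r₁₀ := runs_prepend (x := kn) (y := inp) (z := tmp) (by decide) (by decide) (by decide)
    (M' [.endTable] F (rowsWord P) (rowsWord N) (rowsWord L)) rfl
  have r₁₁ := runs_clear full (M' (encodeSets L) F (rowsWord P) (rowsWord N) (rowsWord L))
  have r₁₂ := runs_clear pos (M' (encodeSets L) [] (rowsWord P) (rowsWord N) (rowsWord L))
  have r₁₃ := runs_clear neg (M' (encodeSets L) [] [] (rowsWord N) (rowsWord L))
  have r₁₄ := runs_clear kn (M' (encodeSets L) [] [] [] (rowsWord L))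
  have r₁₅ := runs_reset (M' (encodeSets L) [] [] [] [])
  simp only [M, M', vals_inp, vals_full, vals_pos, vals_neg, vals_kn, vals_tmp, update_inp,
    update_full, update_pos, update_neg, update_kn, update_tmp, Reg.flags_setCur_none,
    List.append_nil, List.reverse_reverse] at r₁ r₂ r₃ r₄ r₅ r₆ r₉ r₁₀ r₁₁ r₁₂ r₁₃ r₁₄ r₁₅
  rw [← encodeSets_eq] at r₁₀
  refine (r₁.seq <| r₂.seq <| r₃.seq <| r₄.seq <| r₅.seq <| r₆.seq <| r₇.seq <| r₈.seq <|
    r₉.seq <| r₁₀.seq <| r₁₁.seq <| r₁₂.seq <| r₁₃.seq <| r₁₄.seq r₁₅).congr rfl ?_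
  have := Nat.mul_le_mul_right (searchTime hA.time l + askFullTime hA.time l + 1) hcl
  simp only [List.length_reverse, hFl, enumTime]
  linarith only [this, hm, hP, hN, hLl]

end

end Frag

open Classical in
/-- A machine that decides `AMH` in polynomial time yields one that enumerates the minimal hypotheses
in output-polynomial time: each of them is found by one question for every positive example. -/
theorem solvable_MHE_of_inP_AMH (h : InP encodeAMH AMH) :
    SolvableInOutputPolyTime encodePair MHE := by
  obtain ⟨hA⟩ := h
  obtain ⟨T, hT⟩ := (Frag.polyBounded_enumTime hA.time).add (.const 1)
  let _ := hA.tm.kFin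
  let _ := hA.tm.σFin
  refine ⟨⟨(Frag.enumProg hA.inputAlphabet.invFun hA.outputAlphabet).toFinTM2
    (.inr (some .inp)) (.inr (some .inp)) (hA.tm.initialState, Reg.init), Equiv.refl _,
    Equiv.refl _⟩, T, fun K => ?_⟩
  set c := (Finset.univ.filter (RowMinHyp K.posRows K.negRows)).card with hc
  set l := (encodePair K).length + (c * (K.attrCard + 1) + 1) with hl
  have hcl : c * (K.attrCard + 1) ≤ l := by omega
  have hlen : (encodePair K).length = K.attrCard + 1 + ((rowsWord K.posRows).length + 1 +
      ((rowsWord K.negRows).length + 1)) := by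
    rw [encodePair_eq]
    simp only [List.length_append, List.length_cons, List.length_nil, length_cells]
    omega
  obtain ⟨L, hL₁, hL₂, n, hn, hr⟩ := Frag.runs_enumProg hA (P := K.posRows) (N := K.negRows)
    (l := l) (by omega) (by omega) (by omega) hcl
  have hLc : (encodeSets L).length = c * (K.attrCard + 1) + 1 := by
    have : L.toFinset = Finset.univ.filter (RowMinHyp K.posRows K.negRows) := by
      ext H
      simp [hL₂]
    rw [length_encodeSets, hc, ← this, List.toFinset_card_of_nodup hL₁]
  refine ⟨encodeSets L, ⟨L, hL₁, fun H => (hL₂ H).trans (K.isMinimalHypothesis_iff H).symm, rfl⟩,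
    ?_⟩
  rw [hLc, ← hl]
  rw [← encodePair_eq] at hr
  have h₀ : ∀ y, EnumVar.vals y [] [] [] [] [] [] [] [] [] [] =
      update (fun _ => []) EnumVar.inp y := by
    intro y
    funext k
    cases k <;> rfl
  simp only [h₀, stackFun_single_some] at hr
  exact hr.outputs (m := T.eval l) ((Nat.add_le_add_right hn 1).trans (hT _))

end HypothesisEnumeration

theorem mainTheorem4 :
    HypothesisEnumeration.InP HypothesisEnumeration.encodeAMH HypothesisEnumeration.AMH ↔
      HypothesisEnumeration.SolvableInOutputPolyTime
        HypothesisEnumeration.encodePair HypothesisEnumeration.MHE :=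
  ⟨HypothesisEnumeration.solvable_MHE_of_inP_AMH, HypothesisEnumeration.inP_AMH_of_solvable_MHE⟩
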